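/- Let $n,m\ge 0$ and let the controller use the approximate model $\tilde f(x_t\mid u_t,x_{t-1})=\mathcal N(\tilde A x_{t-1}+\tilde B u_t,\tilde\Sigma_{t,\xi})$, where $\tilde A\in\mathbb R^{n\times n}$, $\tilde B\in\mathbb R^{n\times m}$ and $\tilde\Sigma_{t,\xi}$ is positive definite for $t\ge1$. Let the ideal densities be ${}^I\!f(x_t\mid u_t,x_{t-1})=\mathcal N(0,{}^I\Sigma_x)$ and ${}^I\!f(u_t\mid d(t-1))=\mathcal N(0,{}^I\Sigma_u)$ with constant positive definite covariances; here $d(t)=(x_0,u_1,x_1,\dots,u_t,x_t)$. Assume that $(\tilde A,\tilde B)$ is stabilizable, i.e. $\rho(\tilde A-\tilde BK)<1$ for some $K\in\mathbb R^{m\times n}$. For a horizon $T$ put $\gamma_T(d(T))=1$ and, backwards for $t=T,\dots,1$, $$\omega_T(u_t,d(t-1))=\int \tilde f(x_t\mid u_t,x_{t-1})\log\frac{\tilde f(x_t\mid u_t,x_{t-1})}{\gamma_T(d(t))\,{}^I\!f(x_t\mid u_t,x_{t-1})}\,dx_t,$$ $$\gamma_T(d(t-1))=\int {}^I\!f(u_t\mid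 d(t-1))\,e^{-\omega_T(u_t,d(t-1))}\,du_t ,\qquad {}^o\!f_T(u_t\mid d(t-1))=\frac{{}^I\!f(u_t\mid d(t-1))\,e^{-\omega_T(u_t,d(t-1))}}{\gamma_T(d(t-1))}.$$ Define also $\Sigma_{T,\gamma}^{-1}=0$, $L_T=0$ and, backwards for $t=T,\dots,1$, $$\Sigma_{t,\omega}^{-1}={}^I\Sigma_x^{-1}+L_t^T\Sigma_{t,\gamma}^{-1}L_t,\quad \Sigma_{t,u}^{-1}={}^I\Sigma_u^{-1}+\tilde B^T\Sigma_{t,\omega}^{-1}\tilde B,\quad \mu_{t,u}=-\Sigma_{t,u}\tilde B^T\Sigma_{t,\omega}^{-1}\tilde A x_{t-1},$$ $$L_{t-1}=\tilde A,\quad \Sigma_{t-1,\gamma}^{-1}=(\tilde B\,{}^I\Sigma_u\tilde B^T+\Sigma_{t,\omega})^{-1}$$ (all these depend on $T$). **Finite horizon.** For every $T$ all the above integrals converge. For every $x_0$ the strategy ${}^o\!f_T$ is admissible and, among all admissible strategies $\pi$ (measurable conditional densities $\pi(u_t\mid d(t-1))$, $t\le T$), minimizes the Kullback–Leibler divergence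 between the joint densities $\prod_{t\le T}\tilde f(x_t\mid u_t,x_{t-1})\pi(u_t\mid d(t-1))$ and $\prod_{t\le T}{}^I\!f(x_t\mid u_t,x_{t-1})\,{}^I\!f(u_t\mid d(t-1))$; the minimum is finite, and every minimizer has almost everywhere the same joint density as ${}^o\!f_T$. Moreover, for $1\le t\le T$, $\Sigma_{t,u}$ is positive definite and ${}^o\!f_T(u_t\mid d(t-1))=\mathcal N(\mu_{t,u},\Sigma_{t,u})$, and for $0\le t\le T$, $\gamma_T(d(t))=C\exp\!\big(-\tfrac12 (L_tx_t)^T\Sigma_{t,\gamma}^{-1}(L_tx_t)\big)$ with a constant $C=C(T,t)>0$ not depending on the data. **Infinite horizon.** There are positive definite matrices $\Sigma_\omega,\Sigma_\gamma,\Sigma_u$ such that $$\Sigma_u^{-1}={}^I\Sigma_u^{-1}+\tilde B^T\Sigma_\omega^{-1}\tilde B,\qquad \Sigma_\gamma^{-1}=\Sigma_\omega^{-1}(\Sigma_\omega-\tilde B\Sigma_u\tilde B^T)\Sigma_\omega^{-1},$$ $\Sigma_\omega^{-1}$ solves the algebraic Riccati equation $$\Sigma_\omega^{-1}={}^I\Sigma_x^{-1}+\tilde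 A^T\Sigma_\omega^{-1}\tilde A-\tilde A^T\Sigma_\omega^{-1}\tilde B({}^I\Sigma_u^{-1}+\tilde B^T\Sigma_\omega^{-1}\tilde B)^{-1}\tilde B^T\Sigma_\omega^{-1}\tilde A ,$$ and, as $T\to\infty$: for every fixed $t\ge1$ (and all $x_{t-1},u_t$), $\Sigma_{t,\omega}^{-1}\to\Sigma_\omega^{-1}$, $\Sigma_{t,u}\to\Sigma_u$, $\mu_{t,u}\to-\Sigma_u\tilde B^T\Sigma_\omega^{-1}\tilde A x_{t-1}$, and the density ${}^o\!f_T(u_t\mid d(t-1))$ converges to the density of $\mathcal N(-\Sigma_u\tilde B^T\Sigma_\omega^{-1}\tilde Ax_{t-1},\Sigma_u)$ at $u_t$; for every fixed $t\ge0$, $\Sigma_{t,\gamma}^{-1}\to\Sigma_\gamma^{-1}$, and $\gamma_T$ at time $t$, as a function $\gamma_{T,t}(x)$ of $x=x_t$, satisfies $\gamma_{T,t}(x)/\gamma_{T,t}(0)\to\exp(-\tfrac12(\tilde Ax)^T\Sigma_\gamma^{-1}(\tilde Ax))$ for every $x$. -/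

import Mathlib

open MeasureTheory Filter Topology
open scoped Matrix

noncomputable section

namespace FPC

/-- The density at `x` of the nondegenerate multivariate normal law `N(μ, S)` on `ℝᵏ`
(for `S` positive definite), with respect to Lebesgue measure. -/
def gaussianPdf {k : ℕ} (μ : Fin k → ℝ) (S : Matrix (Fin k) (Fin k) ℝ) (x : Fin k → ℝ) : ℝ :=
  (Real.sqrt ((2 * Real.pi) ^ k * S.det))⁻¹ *
    Real.exp (-(1 / 2) * ((x - μ) ⬝ᵥ (S⁻¹ *ᵥ (x - μ))))

/-- The Kullback-Leibler divergence `D(f₁ ‖ f₂)` of two probability densities, with value `∞`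
when the integral of `f₁ log (f₁ / f₂)` diverges or `f₁` does not vanish almost everywhere
where `f₂` vanishes. -/
def klDivPdf {α : Type*} [MeasureSpace α] (f₁ f₂ : α → ℝ) : ENNReal :=
  InformationTheory.klDiv
    ((volume : Measure α).withDensity (fun a => ENNReal.ofReal (f₁ a)))
    ((volume : Measure α).withDensity (fun a => ENNReal.ofReal (f₂ a)))

/-- The data of a Gaussian control problem with `n`-dimensional state and `m`-dimensional input.
All fields are sequences indexed by the time `t = 1, 2, …` (the value at `0` is never used).
The model is `f(x_t | u_t, x_{t-1}) = N(A_t x_{t-1} + B_t u_t, noiseCov_t)`, the ideal densities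
are `N(idealMeanX_t, idealCovX_t)` for `x_t` and `N(idealMeanU_t, idealCovU_t)` for `u_t`. -/
structure GaussianProblem (n m : ℕ) where
  A : ℕ → Matrix (Fin n) (Fin n) ℝ
  B : ℕ → Matrix (Fin n) (Fin m) ℝ
  noiseCov : ℕ → Matrix (Fin n) (Fin n) ℝ
  idealMeanX : ℕ → Fin n → ℝ
  idealCovX : ℕ → Matrix (Fin n) (Fin n) ℝ
  idealMeanU : ℕ → Fin m → ℝ
  idealCovU : ℕ → Matrix (Fin m) (Fin m) ℝ

/-- The observed data `d(k) = (x_0, (u_1, x_1), …, (u_k, x_k))`; the pair `(u_{i+1}, x_{i+1})`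
is stored at index `i`. -/
abbrev History (n m k : ℕ) : Type :=
  (Fin n → ℝ) × (Fin k → (Fin m → ℝ) × (Fin n → ℝ))

/-- The last state `x_k` contained in `d(k)`. -/
def History.lastState {n m : ℕ} : {k : ℕ} → History n m k → (Fin n → ℝ)
  | 0, h => h.1
  | k + 1, h => (h.2 (Fin.last k)).2

/-- The part `d(k)` of a trajectory over the horizon `T ≥ k` that starts in `x₀`. -/
def truncate {n m T : ℕ} (x₀ : Fin n → ℝ) (d : Fin T → (Fin m → ℝ) × (Fin n → ℝ))
    (k : Fin T) : History n m k :=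
  (x₀, fun i => d (Fin.castLE k.isLt.le i))

/-- A control strategy: `π k h u` is the conditional density at `u` of `u_{k+1}` given
`d(k) = h`. -/
abbrev Policy (n m : ℕ) : Type :=
  (k : ℕ) → History n m k → (Fin m → ℝ) → ℝ

/-- Admissibility over the horizon `T`: for `t = k + 1 ≤ T` the strategy is a (jointly measurable)
conditional probability density. -/
def IsAdmissible {n m : ℕ} (T : ℕ) (π : Policy n m) : Prop :=
  ∀ k < T, Measurable (Function.uncurry (π k)) ∧ (∀ h u, 0 ≤ π k h u) ∧ ∀ h, ∫ u, π k h u = 1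

namespace GaussianProblem

variable {n m : ℕ} (D : GaussianProblem n m)

/-- The model density `f(x_t | u_t, x_{t-1})`, as a function of `x_{t-1}`, `u_t`, `x_t`. -/
def modelPdf (t : ℕ) (x : Fin n → ℝ) (u : Fin m → ℝ) (x' : Fin n → ℝ) : ℝ :=
  gaussianPdf (D.A t *ᵥ x + D.B t *ᵥ u) (D.noiseCov t) x'

/-- The ideal density of `x_t`. -/
def idealStatePdf (t : ℕ) (x' : Fin n → ℝ) : ℝ :=
  gaussianPdf (D.idealMeanX t) (D.idealCovX t) x'

/-- The ideal density of `u_t`. -/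
def idealControlPdf (t : ℕ) (u : Fin m → ℝ) : ℝ :=
  gaussianPdf (D.idealMeanU t) (D.idealCovU t) u

/-- The joint density of `d(T)` given `x₀` when the model is controlled by the strategy `π`. -/
def jointPdf (T : ℕ) (π : Policy n m) (x₀ : Fin n → ℝ)
    (d : Fin T → (Fin m → ℝ) × (Fin n → ℝ)) : ℝ :=
  ∏ k : Fin T,
    D.modelPdf (k + 1) (truncate x₀ d k).lastState (d k).1 (d k).2 *
      π k (truncate x₀ d k) (d k).1

/-- The ideal joint density of `d(T)`. -/
def idealJointPdf (T : ℕ) (d : Fin T → (Fin m → ℝ) × (Fin n → ℝ)) : ℝ :=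
  ∏ k : Fin T, D.idealStatePdf (k + 1) (d k).2 * D.idealControlPdf (k + 1) (d k).1

/-- The divergence between the closed loop with strategy `π` and the ideal joint density. -/
def cost (T : ℕ) (π : Policy n m) (x₀ : Fin n → ℝ) : ENNReal :=
  klDivPdf (D.jointPdf T π x₀) (D.idealJointPdf T)

/-! ### The fully probabilistic control algorithm

Since the model and the ideal densities depend on the past only through the last state, the
functions `γ(d(t))` and `ω(u_t, d(t-1))` are functions of `x_t` and of `(u_t, x_{t-1})`. -/

/-- The integrand `f log (f / (γ ᴵf))` in the definition of `ω` at time `t`, where `g` is the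
function `γ` at time `t`. -/
def omegaIntegrand (t : ℕ) (g : (Fin n → ℝ) → ℝ) (x : Fin n → ℝ) (u : Fin m → ℝ)
    (x' : Fin n → ℝ) : ℝ :=
  D.modelPdf t x u x' * Real.log (D.modelPdf t x u x' / (g x' * D.idealStatePdf t x'))

/-- The function `γ` at time `t` when `s` time steps are left, by backward recursion. -/
def gammaToGo : ℕ → ℕ → (Fin n → ℝ) → ℝ
  | 0, _ => fun _ => 1
  | s + 1, t => fun x =>
      ∫ u, D.idealControlPdf (t + 1) u *
        Real.exp (-∫ x', D.omegaIntegrand (t + 1) (gammaToGo s (t + 1)) x u x')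

/-- `γ(d(t))` for the horizon `T`, as a function of `x_t` (for `t ≤ T`). -/
def gammaFn (T t : ℕ) : (Fin n → ℝ) → ℝ :=
  D.gammaToGo (T - t) t

/-- `ω(u_t, d(t-1))` for the horizon `T`, as a function of `x_{t-1}` and `u_t`
(for `1 ≤ t ≤ T`). -/
def omegaFn (T t : ℕ) (x : Fin n → ℝ) (u : Fin m → ℝ) : ℝ :=
  ∫ x', D.omegaIntegrand t (D.gammaFn T t) x u x'

/-- The randomized strategy `ᵒf(u_t | d(t-1)) = ᴵf(u_t) exp (-ω(u_t, d(t-1))) / γ(d(t-1))` for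
the horizon `T`, as a function of `x_{t-1}` and `u_t` (for `1 ≤ t ≤ T`). -/
def controlPdf (T t : ℕ) (x : Fin n → ℝ) (u : Fin m → ℝ) : ℝ :=
  D.idealControlPdf t u * Real.exp (-D.omegaFn T t x u) / D.gammaFn T (t - 1) x

/-- The randomized strategy as an element of the class of all strategies. -/
def controlPolicy (T : ℕ) : Policy n m :=
  fun k h u => D.controlPdf T (k + 1) h.lastState u

end GaussianProblem

/-! ### The backward recursion for the parameters in the Gaussian case -/

/-- The parameters `L_t`, `M_t`, `Σ_{t,γ}⁻¹`. -/
structure GammaParams (n : ℕ) where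
  L : Matrix (Fin n) (Fin n) ℝ
  M : Fin n → ℝ
  prec : Matrix (Fin n) (Fin n) ℝ

namespace GaussianProblem

variable {n m : ℕ} (D : GaussianProblem n m)

/-- `Σ_{t,ω}⁻¹ = ᴵΣ_{t,x}⁻¹ + L_tᵀ Σ_{t,γ}⁻¹ L_t`. -/
def omegaPrecOf (t : ℕ) (g : GammaParams n) : Matrix (Fin n) (Fin n) ℝ :=
  (D.idealCovX t)⁻¹ + g.Lᵀ * g.prec * g.L

/-- `μ_{t,ω} = Σ_{t,ω} (ᴵΣ_{t,x}⁻¹ ᴵμ_{t,x} - L_tᵀ Σ_{t,γ}⁻¹ M_t)`. -/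
def omegaMeanOf (t : ℕ) (g : GammaParams n) : Fin n → ℝ :=
  (D.omegaPrecOf t g)⁻¹ *ᵥ
    ((D.idealCovX t)⁻¹ *ᵥ D.idealMeanX t - (g.Lᵀ * g.prec) *ᵥ g.M)

/-- `Σ_{t,u}`, where `Σ_{t,u}⁻¹ = ᴵΣ_{t,u}⁻¹ + B_tᵀ Σ_{t,ω}⁻¹ B_t`. -/
def policyCovOf (t : ℕ) (g : GammaParams n) : Matrix (Fin m) (Fin m) ℝ :=
  ((D.idealCovU t)⁻¹ + (D.B t)ᵀ * D.omegaPrecOf t g * D.B t)⁻¹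

/-- `μ_{t,u} = Σ_{t,u} (ᴵΣ_{t,u}⁻¹ ᴵμ_{t,u} + B_tᵀ Σ_{t,ω}⁻¹ (μ_{t,ω} - A_t x_{t-1}))`. -/
def policyMeanOf (t : ℕ) (g : GammaParams n) (x : Fin n → ℝ) : Fin m → ℝ :=
  D.policyCovOf t g *ᵥ
    ((D.idealCovU t)⁻¹ *ᵥ D.idealMeanU t +
      ((D.B t)ᵀ * D.omegaPrecOf t g) *ᵥ (D.omegaMeanOf t g - D.A t *ᵥ x))

/-- `(L, M, Σ_γ⁻¹)` at time `t` when `s` time steps are left: zero at the horizon, and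
`L_{t-1} = A_t`, `Σ_{t-1,γ}⁻¹ = (B_t ᴵΣ_{t,u} B_tᵀ + Σ_{t,ω})⁻¹`,
`M_{t-1} = Σ_{t-1,γ} Σ_{t,ω}⁻¹ B_t Σ_{t,u} ᴵΣ_{t,u}⁻¹ ᴵμ_{t,u} - μ_{t,ω}`. -/
def paramsToGo : ℕ → ℕ → GammaParams n
  | 0, _ => ⟨0, 0, 0⟩
  | s + 1, t =>
      let g := paramsToGo s (t + 1)
      let gammaCov := D.B (t + 1) * D.idealCovU (t + 1) * (D.B (t + 1))ᵀ +
        (D.omegaPrecOf (t + 1) g)⁻¹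
      { L := D.A (t + 1)
        M := (gammaCov * D.omegaPrecOf (t + 1) g * D.B (t + 1) * D.policyCovOf (t + 1) g *
            (D.idealCovU (t + 1))⁻¹) *ᵥ D.idealMeanU (t + 1) - D.omegaMeanOf (t + 1) g
        prec := gammaCov⁻¹ }

/-- `(L_t, M_t, Σ_{t,γ}⁻¹)` for the horizon `T` (for `t ≤ T`). -/
def gammaParams (T t : ℕ) : GammaParams n :=
  D.paramsToGo (T - t) t

/-- `Σ_{t,ω}⁻¹` for the horizon `T`. -/
def omegaPrec (T t : ℕ) : Matrix (Fin n) (Fin n) ℝ :=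
  D.omegaPrecOf t (D.gammaParams T t)

/-- `Σ_{t,u}` for the horizon `T`. -/
def policyCov (T t : ℕ) : Matrix (Fin m) (Fin m) ℝ :=
  D.policyCovOf t (D.gammaParams T t)

/-- `μ_{t,u}` for the horizon `T`, as a function of `x_{t-1}`. -/
def policyMean (T t : ℕ) (x : Fin n → ℝ) : Fin m → ℝ :=
  D.policyMeanOf t (D.gammaParams T t) x

end GaussianProblem

/-- The pair `(A, B)` is stabilizable: some feedback gain `K` makes all (complex) eigenvalues of
`A - B K` lie in the open unit disc. -/
def Stabilizable {n m : ℕ} (A : Matrix (Fin n) (Fin n) ℝ) (B : Matrix (Fin n) (Fin m) ℝ) : Prop :=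
  ∃ K : Matrix (Fin m) (Fin n) ℝ,
    spectralRadius ℂ ((A - B * K).map (algebraMap ℝ ℂ)) < 1

/-- The discrete algebraic Riccati equation with state weight `Q` and input weight `R`. -/
def SolvesDARE {n m : ℕ} (A : Matrix (Fin n) (Fin n) ℝ) (B : Matrix (Fin n) (Fin m) ℝ)
    (Q : Matrix (Fin n) (Fin n) ℝ) (R : Matrix (Fin m) (Fin m) ℝ)
    (P : Matrix (Fin n) (Fin n) ℝ) : Prop :=
  P = Q + Aᵀ * P * A - Aᵀ * P * B * (R + Bᵀ * P * B)⁻¹ * Bᵀ * P * A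

end FPC

end

/-! Finite horizon. Suppose that `γ` at time `t` is a constant times `exp(-½ xᵀNx)`, and let `y = A
x_{t-1} + B u_t` be the predicted state. The logarithm inside `ω` is quadratic, and the Gaussian
expectation of a quadratic form differs from its value at the mean by a constant. Hence `ω = c + ½
yᵀPy` with `P = Ix⁻¹ + N`. Multiplying `exp(-ω)` by the ideal input density and completing the
square in `u_t` (`complete_square`) gives a normalised Gaussian in `u_t` times a constant times
`exp(-½ (Ax)ᵀ(B Iu Bᵀ + P⁻¹)⁻¹(Ax))`. So `γ` at time `t-1` has the same shape, and backward
induction yields the parameter recursion (`exists_gammaToGo_eq`, `controlPdf_eq`).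

Optimality. Along a trajectory, the log-likelihood ratio of the optimal closed loop to the ideal
density telescopes: it is a sum of deviations of log ratios from their conditional expectations `ω`,
minus `log γ(x₀)` (`log_jointPdf_controlPolicy_div`). These deviations are martingale differences
under every strategy, because the model kernel is the same for all of them. Thus the cost of `π`
equals the divergence of its closed loop from the optimal closed loop plus the constant `-log
γ(x₀)`, and Gibbs' inequality with its equality case finishes. The analytic point is that the
deviations, of quadratic growth, are integrable. For the optimal strategy second moments are
propagated step by step. For a competitor of finite cost they follow from the entropy inequality
`integrable_mul_of_integrable_exp`, since the ideal density has a square exponential moment.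

Infinite horizon. With `s = T - t` steps left, `Σ_{t,ω}⁻¹` is the `s`-th Riccati iterate started at
`Ix⁻¹`. The Riccati operator is the value of a one-step quadratic minimisation over inputs, hence
monotone in `P`. The iterates therefore increase, and they stay below the infinite-horizon cost of a
stabilising feedback, which is finite because powers of a matrix of spectral radius below one decay
geometrically. By polarisation they converge; the limit dominates the positive definite starting
value and is a fixed point by continuity (`exists_tendsto_riccatiIter`). All other limits follow by
continuity. -/

namespace FPC

/-! ### Quadratic forms, the matrix inversion lemma and completion of the square -/

/-- A positive definite real matrix is a Gram matrix of an invertible one. -/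
lemma exists_transpose_mul_self_of_posDef {k : ℕ} {S : Matrix (Fin k) (Fin k) ℝ}
    (hS : S.PosDef) : ∃ C : Matrix (Fin k) (Fin k) ℝ, C.det ≠ 0 ∧ S = Cᵀ * C := by
  open scoped MatrixOrder in
  obtain ⟨C, hC⟩ := CStarAlgebra.nonneg_iff_eq_star_mul_self.mp hS.posSemidef.nonneg
  have hC' : S = Cᵀ * C := by simpa [Matrix.star_eq_conjTranspose] using hC
  refine ⟨C, fun h => ?_, hC'⟩
  have := hS.det_pos
  simp [hC', h] at this

lemma dotProduct_self_nonneg_real {k : ℕ} (x : Fin k → ℝ) : 0 ≤ x ⬝ᵥ x :=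
  Finset.sum_nonneg fun i _ => mul_self_nonneg (x i)

lemma sq_le_dotProduct_self {k : ℕ} (x : Fin k → ℝ) (i : Fin k) : x i ^ 2 ≤ x ⬝ᵥ x := by
  rw [pow_two]
  exact Finset.single_le_sum (f := fun i => x i * x i) (fun i _ => mul_self_nonneg (x i))
    (Finset.mem_univ i)

/-- A bilinear form is bounded by the sum of the squared Euclidean norms. -/
lemma exists_abs_dotProduct_mulVec_le {k l : ℕ} (N : Matrix (Fin k) (Fin l) ℝ) :
    ∃ K : ℝ, 0 ≤ K ∧ ∀ x y, |x ⬝ᵥ (N *ᵥ y)| ≤ K * (x ⬝ᵥ x + y ⬝ᵥ y) := by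
  refine ⟨∑ i, ∑ j, |N i j|, Finset.sum_nonneg fun i _ => Finset.sum_nonneg fun j _ => abs_nonneg _,
    fun x y => ?_⟩
  have h : x ⬝ᵥ (N *ᵥ y) = ∑ i, ∑ j, x i * (N i j * y j) := by
    simp [dotProduct, Matrix.mulVec, Finset.mul_sum]
  rw [h, Finset.sum_mul]
  refine (Finset.abs_sum_le_sum_abs _ _).trans (Finset.sum_le_sum fun i _ => ?_)
  rw [Finset.sum_mul]
  refine (Finset.abs_sum_le_sum_abs _ _).trans (Finset.sum_le_sum fun j _ => ?_)
  have h1 := sq_le_dotProduct_self x i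
  have h2 := sq_le_dotProduct_self y j
  have h3 : |x i| * |y j| ≤ x ⬝ᵥ x + y ⬝ᵥ y := by
    have := sq_abs (x i)
    have := sq_abs (y j)
    nlinarith [sq_nonneg (|x i| - |y j|), sq_nonneg (x i), sq_nonneg (y j)]
  calc |x i * (N i j * y j)| = |N i j| * (|x i| * |y j|) := by rw [abs_mul, abs_mul]; ring
    _ ≤ _ := mul_le_mul_of_nonneg_left h3 (abs_nonneg _)

/-- A quadratic form is bounded by the squared Euclidean norm. -/
lemma exists_abs_quadratic_le {k : ℕ} (N : Matrix (Fin k) (Fin k) ℝ) :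
    ∃ K : ℝ, 0 ≤ K ∧ ∀ x, |x ⬝ᵥ (N *ᵥ x)| ≤ K * (x ⬝ᵥ x) := by
  obtain ⟨K, hK, h⟩ := exists_abs_dotProduct_mulVec_le N
  exact ⟨2 * K, by positivity, fun x => (h x x).trans (by linarith)⟩

lemma mulVec_dotProduct_mulVec {k l p : ℕ} (A : Matrix (Fin k) (Fin l) ℝ)
    (P : Matrix (Fin k) (Fin k) ℝ) (B : Matrix (Fin k) (Fin p) ℝ)
    (x : Fin l → ℝ) (y : Fin p → ℝ) :
    (A *ᵥ x) ⬝ᵥ (P *ᵥ (B *ᵥ y)) = x ⬝ᵥ ((Aᵀ * P * B) *ᵥ y) := by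
  rw [dotProduct_comm, Matrix.dotProduct_mulVec, ← Matrix.mulVec_transpose, dotProduct_comm,
    Matrix.mulVec_mulVec, Matrix.mulVec_mulVec]

lemma exists_mulVec_dotProduct_self_le {k l : ℕ} (A : Matrix (Fin k) (Fin l) ℝ) :
    ∃ K : ℝ, 0 ≤ K ∧ ∀ x, (A *ᵥ x) ⬝ᵥ (A *ᵥ x) ≤ K * (x ⬝ᵥ x) := by
  obtain ⟨K, hK, h⟩ := exists_abs_quadratic_le
    (Aᵀ * (1 : Matrix (Fin k) (Fin k) ℝ) * A)
  refine ⟨K, hK, fun x => ?_⟩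
  have := mulVec_dotProduct_mulVec A 1 A x x
  rw [Matrix.one_mulVec] at this
  rw [this]
  exact (le_abs_self _).trans (h x)

lemma add_dotProduct_self_le {k : ℕ} (x y : Fin k → ℝ) :
    (x + y) ⬝ᵥ (x + y) ≤ 2 * (x ⬝ᵥ x) + 2 * (y ⬝ᵥ y) := by
  have := dotProduct_self_nonneg_real (x - y)
  simp only [sub_dotProduct, dotProduct_sub, add_dotProduct, dotProduct_add] at this ⊢
  linarith

lemma quadratic_nonneg {k : ℕ} {P : Matrix (Fin k) (Fin k) ℝ} (hP : P.PosSemidef)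
    (x : Fin k → ℝ) : 0 ≤ x ⬝ᵥ (P *ᵥ x) := by
  simpa using hP.dotProduct_mulVec_nonneg x

lemma dotProduct_mulVec_comm {k : ℕ} {P : Matrix (Fin k) (Fin k) ℝ} (hP : Pᵀ = P)
    (x y : Fin k → ℝ) : x ⬝ᵥ (P *ᵥ y) = y ⬝ᵥ (P *ᵥ x) := by
  conv_rhs => rw [Matrix.dotProduct_mulVec, ← Matrix.mulVec_transpose, hP, dotProduct_comm]

lemma quadratic_add {k : ℕ} {P : Matrix (Fin k) (Fin k) ℝ} (hP : Pᵀ = P) (x y : Fin k → ℝ) :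
    (x + y) ⬝ᵥ (P *ᵥ (x + y)) =
      x ⬝ᵥ (P *ᵥ x) + 2 * (y ⬝ᵥ (P *ᵥ x)) + y ⬝ᵥ (P *ᵥ y) := by
  simp only [Matrix.mulVec_add, add_dotProduct, dotProduct_add]
  rw [dotProduct_mulVec_comm hP x y]
  ring

lemma PosDef.transpose_eq {k : ℕ} {P : Matrix (Fin k) (Fin k) ℝ} (hP : P.PosDef) : Pᵀ = P := by
  simpa using hP.isHermitian.eq

/-- Positive definiteness of `R⁻¹ + Bᵀ P B`. -/
lemma posDef_inv_add {n m : ℕ} {R : Matrix (Fin m) (Fin m) ℝ} {P : Matrix (Fin n) (Fin n) ℝ}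
    (B : Matrix (Fin n) (Fin m) ℝ) (hR : R.PosDef) (hP : P.PosDef) :
    (R⁻¹ + Bᵀ * P * B).PosDef := by
  refine hR.inv.add_posSemidef ?_
  simpa using hP.posSemidef.conjTranspose_mul_mul_same B

/-- The matrix inversion lemma. -/
lemma inv_mul_mul_add_inv {n m : ℕ} {R : Matrix (Fin m) (Fin m) ℝ} {P : Matrix (Fin n) (Fin n) ℝ}
    (B : Matrix (Fin n) (Fin m) ℝ) (hR : R.PosDef) (hP : P.PosDef) :
    (B * R * Bᵀ + P⁻¹)⁻¹ = P - P * B * (R⁻¹ + Bᵀ * P * B)⁻¹ * Bᵀ * P := by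
  have := hP.isUnit.invertible
  rw [add_comm, Matrix.add_mul_mul_inv_eq_sub _ _ _ _ hP.inv.isUnit hR.isUnit]
  · simp
  · simpa using (posDef_inv_add B hR hP).isUnit

lemma posDef_mul_mul_add_inv {n m : ℕ} {R : Matrix (Fin m) (Fin m) ℝ}
    {P : Matrix (Fin n) (Fin n) ℝ} (B : Matrix (Fin n) (Fin m) ℝ) (hR : R.PosDef)
    (hP : P.PosDef) : (B * R * Bᵀ + P⁻¹).PosDef := by
  rw [add_comm]
  refine hP.inv.add_posSemidef ?_
  simpa using hR.posSemidef.mul_mul_conjTranspose_same B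

/-- Completion of the square. -/
lemma complete_square {n m : ℕ} {R : Matrix (Fin m) (Fin m) ℝ} {P : Matrix (Fin n) (Fin n) ℝ}
    (B : Matrix (Fin n) (Fin m) ℝ) (hR : R.PosDef) (hP : P.PosDef) (y : Fin n → ℝ)
    (u : Fin m → ℝ) :
    u ⬝ᵥ (R⁻¹ *ᵥ u) + (y + B *ᵥ u) ⬝ᵥ (P *ᵥ (y + B *ᵥ u)) =
      (u + (R⁻¹ + Bᵀ * P * B)⁻¹ *ᵥ ((Bᵀ * P) *ᵥ y)) ⬝ᵥ
        ((R⁻¹ + Bᵀ * P * B) *ᵥ (u + (R⁻¹ + Bᵀ * P * B)⁻¹ *ᵥ ((Bᵀ * P) *ᵥ y))) +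
      y ⬝ᵥ ((B * R * Bᵀ + P⁻¹)⁻¹ *ᵥ y) := by
  set W := R⁻¹ + Bᵀ * P * B with hW
  have hWp : W.PosDef := posDef_inv_add B hR hP
  have := hWp.isUnit.invertible
  have hPt := PosDef.transpose_eq hP
  rw [inv_mul_mul_add_inv B hR hP, ← hW, quadratic_add hPt, quadratic_add (PosDef.transpose_eq hWp)]
  have e1 : W *ᵥ (W⁻¹ *ᵥ ((Bᵀ * P) *ᵥ y)) = (Bᵀ * P) *ᵥ y := by
    rw [Matrix.mulVec_mulVec, Matrix.mul_inv_of_invertible, Matrix.one_mulVec]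
  rw [dotProduct_mulVec_comm (PosDef.transpose_eq hWp) (W⁻¹ *ᵥ ((Bᵀ * P) *ᵥ y)) u, e1]
  have e2 : u ⬝ᵥ (W *ᵥ u) = u ⬝ᵥ (R⁻¹ *ᵥ u) + (B *ᵥ u) ⬝ᵥ (P *ᵥ (B *ᵥ u)) := by
    rw [mulVec_dotProduct_mulVec, hW, Matrix.add_mulVec, dotProduct_add]
  have e3 : (B *ᵥ u) ⬝ᵥ (P *ᵥ y) = u ⬝ᵥ ((Bᵀ * P) *ᵥ y) := by
    have := mulVec_dotProduct_mulVec B P 1 u y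
    simpa using this
  have e4 : (W⁻¹ *ᵥ ((Bᵀ * P) *ᵥ y)) ⬝ᵥ ((Bᵀ * P) *ᵥ y) =
      y ⬝ᵥ ((P * B * W⁻¹ * Bᵀ * P) *ᵥ y) := by
    rw [dotProduct_comm]
    have := mulVec_dotProduct_mulVec (Bᵀ * P) W⁻¹ (Bᵀ * P) y y
    rw [this]
    simp only [Matrix.transpose_mul, Matrix.transpose_transpose, hPt, Matrix.mul_assoc]
  rw [e2, e3, e4, Matrix.sub_mulVec, dotProduct_sub]
  ring

/-! ### Gaussian integrals and moments -/

lemma measurableEmbedding_mulVec {k : ℕ} {C : Matrix (Fin k) (Fin k) ℝ} (hC : C.det ≠ 0) :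
    MeasurableEmbedding (fun z : Fin k → ℝ => C *ᵥ z) := by
  refine Continuous.measurableEmbedding (by fun_prop) ?_
  exact Matrix.mulVec_injective_iff_isUnit.mpr
    ((Matrix.isUnit_iff_isUnit_det C).mpr (isUnit_iff_ne_zero.mpr hC))

lemma map_mulVec_volume {k : ℕ} {C : Matrix (Fin k) (Fin k) ℝ} (hC : C.det ≠ 0) :
    Measure.map (fun z : Fin k → ℝ => C *ᵥ z) volume =
      ENNReal.ofReal |C.det⁻¹| • (volume : Measure (Fin k → ℝ)) := by
  rw [← Real.map_matrix_volume_pi_eq_smul_volume_pi hC]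
  rfl

lemma integrable_comp_mulVec {k : ℕ} {C : Matrix (Fin k) (Fin k) ℝ} (hC : C.det ≠ 0)
    {f : (Fin k → ℝ) → ℝ} (hf : Integrable f) : Integrable (fun z => f (C *ᵥ z)) := by
  have := (measurableEmbedding_mulVec hC).integrable_map_iff (μ := volume) (g := f)
  rw [map_mulVec_volume hC] at this
  exact this.mp (hf.smul_measure ENNReal.ofReal_ne_top)

lemma integral_comp_mulVec {k : ℕ} {C : Matrix (Fin k) (Fin k) ℝ} (hC : C.det ≠ 0)
    (f : (Fin k → ℝ) → ℝ) : ∫ z, f (C *ᵥ z) = |C.det|⁻¹ * ∫ z, f z := by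
  rw [← (measurableEmbedding_mulVec hC).integral_map (μ := volume) f, map_mulVec_volume hC,
    integral_smul_measure, ENNReal.toReal_ofReal (abs_nonneg _), abs_inv, smul_eq_mul]

lemma exp_neg_mul_dotProduct_self {k : ℕ} (b : ℝ) (z : Fin k → ℝ) :
    Real.exp (-b * (z ⬝ᵥ z)) = ∏ i, Real.exp (-b * z i ^ 2) := by
  rw [← Real.exp_sum, dotProduct, Finset.mul_sum]
  simp only [pow_two]

lemma integrable_exp_neg_mul_dotProduct_self {k : ℕ} {b : ℝ} (hb : 0 < b) :
    Integrable (fun z : Fin k → ℝ => Real.exp (-b * (z ⬝ᵥ z))) := by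
  simp only [exp_neg_mul_dotProduct_self]
  exact Integrable.fintype_prod (f := fun (_ : Fin k) (x : ℝ) => Real.exp (-b * x ^ 2))
    fun _ => integrable_exp_neg_mul_sq hb

lemma integral_exp_neg_half_dotProduct_self (k : ℕ) :
    ∫ z : Fin k → ℝ, Real.exp (-(1 / 2) * (z ⬝ᵥ z)) = Real.sqrt ((2 * Real.pi) ^ k) := by
  simp only [exp_neg_mul_dotProduct_self]
  rw [integral_fintype_prod_volume_eq_pow (fun x : ℝ => Real.exp (-(1 / 2) * x ^ 2)),
    integral_gaussian, Fintype.card_fin, Real.sqrt_eq_rpow, Real.sqrt_eq_rpow, ← Real.rpow_natCast,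
    ← Real.rpow_natCast, ← Real.rpow_mul (by positivity), ← Real.rpow_mul (by positivity),
    mul_comm (1 / 2 : ℝ)]
  congr 1
  ring

lemma gaussianPdf_eq_sub {k : ℕ} (μ : Fin k → ℝ) (S : Matrix (Fin k) (Fin k) ℝ) (x : Fin k → ℝ) :
    gaussianPdf μ S x = gaussianPdf 0 S (x - μ) := by
  simp [gaussianPdf]

/-- The normalising constant of a Gaussian density. -/
lemma gaussianPdf_const_pos {k : ℕ} {S : Matrix (Fin k) (Fin k) ℝ} (hS : S.PosDef) :
    0 < (Real.sqrt ((2 * Real.pi) ^ k * S.det))⁻¹ := by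
  have := hS.det_pos
  positivity

lemma gaussianPdf_pos {k : ℕ} {S : Matrix (Fin k) (Fin k) ℝ} (hS : S.PosDef) (μ x : Fin k → ℝ) :
    0 < gaussianPdf μ S x :=
  mul_pos (gaussianPdf_const_pos hS) (Real.exp_pos _)

lemma continuous_gaussianPdf {k : ℕ} (S : Matrix (Fin k) (Fin k) ℝ) :
    Continuous (fun p : (Fin k → ℝ) × (Fin k → ℝ) => gaussianPdf p.1 S p.2) := by
  unfold gaussianPdf
  fun_prop

/-- A Gaussian density in coordinates in which the covariance is the identity. -/
lemma exists_gaussianPdf_eq {k : ℕ} {S : Matrix (Fin k) (Fin k) ℝ} (hS : S.PosDef) :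
    ∃ C : Matrix (Fin k) (Fin k) ℝ, C.det ≠ 0 ∧ S.det = (C.det ^ 2)⁻¹ ∧ ∀ z,
      gaussianPdf 0 S z = (Real.sqrt ((2 * Real.pi) ^ k * S.det))⁻¹ *
        Real.exp (-(1 / 2) * ((C *ᵥ z) ⬝ᵥ (C *ᵥ z))) := by
  obtain ⟨C, hC, h⟩ := exists_transpose_mul_self_of_posDef hS.inv
  refine ⟨C, hC, ?_, fun z => ?_⟩
  · have h1 : (S⁻¹).det = C.det ^ 2 := by rw [h, Matrix.det_mul, Matrix.det_transpose, pow_two]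
    rw [← h1, Matrix.det_nonsing_inv, Ring.inverse_eq_inv', inv_inv]
  · have := mulVec_dotProduct_mulVec C 1 C z z
    rw [Matrix.one_mulVec, Matrix.mul_one] at this
    rw [gaussianPdf, h, this, sub_zero]

lemma integral_gaussianPdf_zero {k : ℕ} {S : Matrix (Fin k) (Fin k) ℝ} (hS : S.PosDef) :
    ∫ x, gaussianPdf 0 S x = 1 := by
  obtain ⟨C, hC, hd, h⟩ := exists_gaussianPdf_eq hS
  simp only [h]
  rw [integral_const_mul, integral_comp_mulVec hC (fun y => Real.exp (-(1 / 2) * (y ⬝ᵥ y))),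
    integral_exp_neg_half_dotProduct_self, Real.sqrt_mul (by positivity), hd, Real.sqrt_inv,
    Real.sqrt_sq_eq_abs]
  have : |C.det| ≠ 0 := abs_ne_zero.mpr hC
  have : Real.sqrt ((2 * Real.pi) ^ k) ≠ 0 := by positivity
  field_simp

/-- Gaussian densities integrate to one. -/
lemma integral_gaussianPdf {k : ℕ} {S : Matrix (Fin k) (Fin k) ℝ} (hS : S.PosDef)
    (μ : Fin k → ℝ) : ∫ x, gaussianPdf μ S x = 1 := by
  simp only [gaussianPdf_eq_sub μ]
  rw [integral_sub_right_eq_self (fun x => gaussianPdf 0 S x)]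
  exact integral_gaussianPdf_zero hS

lemma integrable_gaussianPdf {k : ℕ} {S : Matrix (Fin k) (Fin k) ℝ} (hS : S.PosDef)
    (μ : Fin k → ℝ) : Integrable (fun x => gaussianPdf μ S x) :=
  Integrable.of_integral_ne_zero (by rw [integral_gaussianPdf hS]; exact one_ne_zero)

/-- A centred Gaussian has some square exponential moment. -/
lemma exists_integrable_exp_mul_gaussianPdf {k : ℕ} {S : Matrix (Fin k) (Fin k) ℝ}
    (hS : S.PosDef) :
    ∃ ε : ℝ, 0 < ε ∧ Integrable (fun x => Real.exp (ε * (x ⬝ᵥ x)) * gaussianPdf 0 S x) := by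
  obtain ⟨C, hC, -, h⟩ := exists_gaussianPdf_eq hS
  obtain ⟨K, hK, hle⟩ := exists_mulVec_dotProduct_self_le C⁻¹
  -- Since `|x|² ≤ K |Cx|²`, this `ε` gives `ε|x|² ≤ ¼|Cx|²`, which uses up only half of the
  -- Gaussian exponent `-½|Cx|²`. The `+ 1` covers `K = 0`.
  have hε : 0 < 1 / (4 * (K + 1)) := by positivity
  refine ⟨1 / (4 * (K + 1)), hε, ?_⟩
  have hint := ((integrable_comp_mulVec hC
    (integrable_exp_neg_mul_dotProduct_self (k := k) (b := 1 / 4) (by norm_num))).const_mul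
    (Real.sqrt ((2 * Real.pi) ^ k * S.det))⁻¹)
  refine hint.mono' ?_ (ae_of_all _ fun x => ?_)
  · refine Continuous.aestronglyMeasurable (Continuous.mul (by fun_prop) ?_)
    exact (continuous_gaussianPdf S).comp (Continuous.prodMk continuous_const continuous_id)
  · rw [Real.norm_eq_abs, abs_of_nonneg
      (mul_nonneg (Real.exp_pos _).le (gaussianPdf_pos hS _ _).le), h,
      mul_left_comm, ← Real.exp_add]
    refine mul_le_mul_of_nonneg_left (Real.exp_le_exp.mpr ?_) (gaussianPdf_const_pos hS).le
    have hx : C⁻¹ *ᵥ (C *ᵥ x) = x := by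
      rw [Matrix.mulVec_mulVec, Matrix.nonsing_inv_mul _ (isUnit_iff_ne_zero.mpr hC),
        Matrix.one_mulVec]
    have h1 := hle (C *ᵥ x)
    rw [hx] at h1
    have h0 := dotProduct_self_nonneg_real (C *ᵥ x)
    have h2 : 1 / (4 * (K + 1)) * (x ⬝ᵥ x) ≤ 1 / 4 * ((C *ᵥ x) ⬝ᵥ (C *ᵥ x)) := by
      rw [one_div_mul_eq_div, div_le_iff₀ (by positivity)]
      nlinarith
    linarith

/-- Lets an exponential moment, however small `ε` is, absorb quadratic growth. -/
lemma one_add_le_mul_exp {ε t : ℝ} (hε : 0 < ε) (ht : 0 ≤ t) :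
    1 + t ≤ (1 + ε⁻¹) * Real.exp (ε * t) := by
  have h1 := Real.add_one_le_exp (ε * t)
  have h2 : 0 < ε⁻¹ := inv_pos.mpr hε
  have h3 : ε⁻¹ * (ε * t + 1) ≤ ε⁻¹ * Real.exp (ε * t) := mul_le_mul_of_nonneg_left h1 h2.le
  have h4 : ε⁻¹ * (ε * t) = t := by field_simp
  have h5 : 1 ≤ Real.exp (ε * t) := Real.one_le_exp (by positivity)
  nlinarith

lemma integrable_gaussianPdf_mul_of_le {k : ℕ} {S : Matrix (Fin k) (Fin k) ℝ} (hS : S.PosDef)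
    (μ : Fin k → ℝ) {g : (Fin k → ℝ) → ℝ} (hg : Continuous g) {K : ℝ}
    (hle : ∀ x, |g x| ≤ K * (1 + x ⬝ᵥ x)) :
    Integrable (fun x => gaussianPdf μ S x * g x) := by
  have hK : 0 ≤ K := by simpa using (abs_nonneg _).trans (hle 0)
  obtain ⟨ε, hε, h⟩ := exists_integrable_exp_mul_gaussianPdf hS
  -- The factor `2(1 + |μ|²)` comes from `1 + |x|² ≤ 2(1 + |μ|²)(1 + |x - μ|²)`, the factor `1 +
  -- ε⁻¹` from `one_add_le_mul_exp` applied to `|x - μ|²`.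
  have h0 := ((h.const_mul (2 * K * (1 + μ ⬝ᵥ μ) * (1 + ε⁻¹))).comp_sub_right μ)
  refine h0.mono' ?_ (ae_of_all _ fun x => ?_)
  · refine Continuous.aestronglyMeasurable (Continuous.mul ?_ hg)
    exact (continuous_gaussianPdf S).comp (Continuous.prodMk continuous_const continuous_id)
  · have hp := gaussianPdf_pos hS 0 (x - μ)
    rw [norm_mul, Real.norm_eq_abs, Real.norm_eq_abs, gaussianPdf_eq_sub, abs_of_pos hp]
    have h1 := one_add_le_mul_exp hε (dotProduct_self_nonneg_real (x - μ))
    have h2 := add_dotProduct_self_le (x - μ) μ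
    rw [sub_add_cancel] at h2
    have h3 := dotProduct_self_nonneg_real μ
    have h4 := dotProduct_self_nonneg_real (x - μ)
    have h5 : 1 + x ⬝ᵥ x ≤ 2 * (1 + μ ⬝ᵥ μ) * (1 + (x - μ) ⬝ᵥ (x - μ)) := by nlinarith
    calc gaussianPdf 0 S (x - μ) * |g x|
        ≤ gaussianPdf 0 S (x - μ) * (K * (2 * (1 + μ ⬝ᵥ μ) *
            ((1 + ε⁻¹) * Real.exp (ε * ((x - μ) ⬝ᵥ (x - μ)))))) := by
          refine mul_le_mul_of_nonneg_left ((hle x).trans ?_) hp.le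
          refine mul_le_mul_of_nonneg_left (h5.trans ?_) hK
          exact mul_le_mul_of_nonneg_left h1 (by positivity)
      _ = _ := by ring

/-- The expectation of a quadratic form under a Gaussian law. -/
lemma exists_integral_gaussianPdf_mul_quadratic {k : ℕ} {S N : Matrix (Fin k) (Fin k) ℝ}
    (hS : S.PosDef) (hN : Nᵀ = N) :
    ∃ c : ℝ, ∀ μ, ∫ x, gaussianPdf μ S x * (x ⬝ᵥ (N *ᵥ x)) = μ ⬝ᵥ (N *ᵥ μ) + c := by
  -- After the shift `x = z + μ`, the constant is the expectation under the centred law.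
  refine ⟨∫ z, gaussianPdf 0 S z * (z ⬝ᵥ (N *ᵥ z)), fun μ => ?_⟩
  obtain ⟨K, hK, hle⟩ := exists_abs_quadratic_le N
  obtain ⟨K', hK', hle'⟩ := exists_abs_dotProduct_mulVec_le N
  have i1 : Integrable (fun z => gaussianPdf 0 S z * (z ⬝ᵥ (N *ᵥ z))) :=
    integrable_gaussianPdf_mul_of_le hS 0 (by fun_prop) (K := K)
      fun x => (hle x).trans (by nlinarith)
  have i2 : Integrable (fun z => gaussianPdf 0 S z * (z ⬝ᵥ (N *ᵥ μ))) := by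
    refine integrable_gaussianPdf_mul_of_le hS 0 (by fun_prop) (K := K' * (1 + μ ⬝ᵥ μ))
      fun x => (hle' x μ).trans ?_
    have := dotProduct_self_nonneg_real x
    have := dotProduct_self_nonneg_real μ
    rw [mul_assoc]
    refine mul_le_mul_of_nonneg_left ?_ hK'
    nlinarith
  -- The cross term vanishes because its integrand is odd in `z`.
  have hodd : ∫ z, gaussianPdf 0 S z * (z ⬝ᵥ (N *ᵥ μ)) = 0 := by
    have := integral_neg_eq_self (fun z => gaussianPdf 0 S z * (z ⬝ᵥ (N *ᵥ μ))) volume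
    have h' : ∀ z, gaussianPdf 0 S (-z) * ((-z) ⬝ᵥ (N *ᵥ μ)) =
        -(gaussianPdf 0 S z * (z ⬝ᵥ (N *ᵥ μ))) := fun z => by
      simp [gaussianPdf, Matrix.mulVec_neg]
    simp only [h', integral_neg] at this
    linarith
  have hsh : ∫ x, gaussianPdf μ S x * (x ⬝ᵥ (N *ᵥ x)) =
      ∫ z, gaussianPdf 0 S z * ((z + μ) ⬝ᵥ (N *ᵥ (z + μ))) := by
    rw [← integral_sub_right_eq_self
      (fun z => gaussianPdf 0 S z * ((z + μ) ⬝ᵥ (N *ᵥ (z + μ)))) μ]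
    simp only [← gaussianPdf_eq_sub, sub_add_cancel]
  have hexp : ∀ z, gaussianPdf 0 S z * ((z + μ) ⬝ᵥ (N *ᵥ (z + μ))) =
      gaussianPdf 0 S z * (z ⬝ᵥ (N *ᵥ z)) + 2 * (gaussianPdf 0 S z * (z ⬝ᵥ (N *ᵥ μ))) +
        gaussianPdf 0 S z * (μ ⬝ᵥ (N *ᵥ μ)) := fun z => by
    rw [quadratic_add hN, dotProduct_mulVec_comm hN μ z]
    ring
  rw [hsh]
  simp only [hexp]
  have i3 : Integrable (fun z => gaussianPdf 0 S z * (z ⬝ᵥ (N *ᵥ z)) +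
      2 * (gaussianPdf 0 S z * (z ⬝ᵥ (N *ᵥ μ)))) := i1.add (i2.const_mul 2)
  rw [integral_add i3 ((integrable_gaussianPdf hS 0).mul_const _),
    integral_add i1 (i2.const_mul 2), integral_const_mul, hodd, integral_mul_const,
    integral_gaussianPdf hS]
  ring

/-- The second moment of a Gaussian law grows at most quadratically with the mean. -/
lemma exists_integral_gaussianPdf_mul_le {k : ℕ} {S : Matrix (Fin k) (Fin k) ℝ}
    (hS : S.PosDef) :
    ∃ K : ℝ, 0 ≤ K ∧ ∀ μ, Integrable (fun x => gaussianPdf μ S x * (1 + x ⬝ᵥ x)) ∧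
      ∫ x, gaussianPdf μ S x * (1 + x ⬝ᵥ x) ≤ K * (1 + μ ⬝ᵥ μ) := by
  obtain ⟨c, hc⟩ := exists_integral_gaussianPdf_mul_quadratic hS (N := 1) (by simp)
  simp only [Matrix.one_mulVec] at hc
  refine ⟨1 + |c|, by positivity, fun μ => ⟨?_, ?_⟩⟩
  · refine integrable_gaussianPdf_mul_of_le hS μ (by fun_prop) (K := 1) fun x => ?_
    rw [abs_of_nonneg (by linarith [dotProduct_self_nonneg_real x]), one_mul]
  · have i1 : Integrable (fun x => gaussianPdf μ S x * (x ⬝ᵥ x)) := by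
      refine integrable_gaussianPdf_mul_of_le hS μ (by fun_prop) (K := 1) fun x => ?_
      rw [abs_of_nonneg (dotProduct_self_nonneg_real x), one_mul]
      linarith
    simp only [mul_add, mul_one]
    rw [integral_add (integrable_gaussianPdf hS μ) i1, integral_gaussianPdf hS, hc]
    have := dotProduct_self_nonneg_real μ
    nlinarith [le_abs_self c, abs_nonneg c]

/-! ### The Riccati operator as the value of a one-step control problem -/

lemma continuousAt_inv_of_posDef {k : ℕ} {P : Matrix (Fin k) (Fin k) ℝ} (hP : P.PosDef) :
    ContinuousAt (fun X : Matrix (Fin k) (Fin k) ℝ => X⁻¹) P := by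
  refine continuousAt_matrix_inv P ?_
  simp only [Ring.inverse_eq_inv']
  exact continuousAt_inv₀ hP.det_pos.ne'

section Riccati

variable {n m : ℕ} (A : Matrix (Fin n) (Fin n) ℝ) (B : Matrix (Fin n) (Fin m) ℝ)
  (Q : Matrix (Fin n) (Fin n) ℝ) (R : Matrix (Fin m) (Fin m) ℝ)

/-- The Riccati operator with state weight `Q` and input weight `R⁻¹`. -/
noncomputable def riccatiMap (P : Matrix (Fin n) (Fin n) ℝ) : Matrix (Fin n) (Fin n) ℝ :=
  Q + Aᵀ * (B * R * Bᵀ + P⁻¹)⁻¹ * A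

/-- The Riccati iteration, started in the state weight. -/
noncomputable def riccatiIter : ℕ → Matrix (Fin n) (Fin n) ℝ
  | 0 => Q
  | s + 1 => riccatiMap A B Q R (riccatiIter s)

variable {A B Q R}

lemma posDef_riccatiMap (hQ : Q.PosDef) (hR : R.PosDef) {P : Matrix (Fin n) (Fin n) ℝ}
    (hP : P.PosDef) : (riccatiMap A B Q R P).PosDef := by
  refine hQ.add_posSemidef ?_
  simpa using (posDef_mul_mul_add_inv B hR hP).inv.posSemidef.conjTranspose_mul_mul_same A

lemma posDef_riccatiIter (hQ : Q.PosDef) (hR : R.PosDef) (s : ℕ) :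
    (riccatiIter A B Q R s).PosDef := by
  induction s with
  | zero => exact hQ
  | succ s ih => exact posDef_riccatiMap hQ hR ih

/-- The matrix inversion lemma turns `(B R Bᵀ + P⁻¹)⁻¹` into the subtracted form of the algebraic
Riccati equation. -/
lemma solvesDARE_of_riccatiMap_eq (hR : R.PosDef) {P : Matrix (Fin n) (Fin n) ℝ} (hP : P.PosDef)
    (h : riccatiMap A B Q R P = P) : SolvesDARE A B Q R⁻¹ P := by
  unfold SolvesDARE
  conv_lhs => rw [← h, riccatiMap, inv_mul_mul_add_inv B hR hP]
  simp only [Matrix.mul_sub, Matrix.sub_mul, Matrix.mul_assoc, add_sub_assoc]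

lemma quadratic_riccatiMap (P : Matrix (Fin n) (Fin n) ℝ) (x : Fin n → ℝ) :
    x ⬝ᵥ (riccatiMap A B Q R P *ᵥ x) =
      x ⬝ᵥ (Q *ᵥ x) + (A *ᵥ x) ⬝ᵥ ((B * R * Bᵀ + P⁻¹)⁻¹ *ᵥ (A *ᵥ x)) := by
  rw [riccatiMap, Matrix.add_mulVec, dotProduct_add, mulVec_dotProduct_mulVec]

/-- The Riccati operator yields the cost of an arbitrary input at most. -/
lemma quadratic_riccatiMap_le (hR : R.PosDef) {P : Matrix (Fin n) (Fin n) ℝ}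
    (hP : P.PosDef) (x : Fin n → ℝ) (u : Fin m → ℝ) :
    x ⬝ᵥ (riccatiMap A B Q R P *ᵥ x) ≤ x ⬝ᵥ (Q *ᵥ x) +
      (u ⬝ᵥ (R⁻¹ *ᵥ u) + (A *ᵥ x + B *ᵥ u) ⬝ᵥ (P *ᵥ (A *ᵥ x + B *ᵥ u))) := by
  rw [quadratic_riccatiMap, complete_square B hR hP]
  have := quadratic_nonneg (posDef_inv_add B hR hP).posSemidef
    (u + (R⁻¹ + Bᵀ * P * B)⁻¹ *ᵥ ((Bᵀ * P) *ᵥ (A *ᵥ x)))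
  linarith

/-- The Riccati operator yields the cost of the optimal input. -/
lemma exists_quadratic_riccatiMap_eq (hR : R.PosDef) {P : Matrix (Fin n) (Fin n) ℝ}
    (hP : P.PosDef) (x : Fin n → ℝ) :
    ∃ u : Fin m → ℝ, x ⬝ᵥ (riccatiMap A B Q R P *ᵥ x) = x ⬝ᵥ (Q *ᵥ x) +
      (u ⬝ᵥ (R⁻¹ *ᵥ u) + (A *ᵥ x + B *ᵥ u) ⬝ᵥ (P *ᵥ (A *ᵥ x + B *ᵥ u))) := by
  refine ⟨-((R⁻¹ + Bᵀ * P * B)⁻¹ *ᵥ ((Bᵀ * P) *ᵥ (A *ᵥ x))), ?_⟩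
  rw [quadratic_riccatiMap, complete_square B hR hP]
  simp

/-- The input that is optimal for `P'` is a candidate for `P`, where it costs no more. -/
lemma quadratic_riccatiMap_mono (hR : R.PosDef) {P P' : Matrix (Fin n) (Fin n) ℝ}
    (hP : P.PosDef) (hP' : P'.PosDef) (h : ∀ x, x ⬝ᵥ (P *ᵥ x) ≤ x ⬝ᵥ (P' *ᵥ x)) (x : Fin n → ℝ) :
    x ⬝ᵥ (riccatiMap A B Q R P *ᵥ x) ≤ x ⬝ᵥ (riccatiMap A B Q R P' *ᵥ x) := by
  obtain ⟨u, hu⟩ := exists_quadratic_riccatiMap_eq (A := A) (B := B) (Q := Q) hR hP' x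
  rw [hu]
  refine (quadratic_riccatiMap_le hR hP x u).trans ?_
  linarith [h (A *ᵥ x + B *ᵥ u)]

/-- The first step only adds a nonnegative form to `Q`; monotonicity of the operator propagates the
inequality. -/
lemma quadratic_riccatiIter_le_succ (hQ : Q.PosDef) (hR : R.PosDef) (s : ℕ) :
    ∀ x, x ⬝ᵥ (riccatiIter A B Q R s *ᵥ x) ≤ x ⬝ᵥ (riccatiIter A B Q R (s + 1) *ᵥ x) := by
  induction s with
  | zero =>
    intro x
    rw [riccatiIter, riccatiIter, quadratic_riccatiMap]
    have := quadratic_nonneg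
      (posDef_mul_mul_add_inv B hR (posDef_riccatiIter (A := A) (B := B) hQ hR 0)).inv.posSemidef
      (A *ᵥ x)
    linarith
  | succ s ih =>
    exact quadratic_riccatiMap_mono hR (posDef_riccatiIter hQ hR s)
      (posDef_riccatiIter hQ hR (s + 1)) ih

/-- The Riccati iteration is bounded by the cost of a linear feedback. -/
lemma quadratic_riccatiIter_le_sum (hQ : Q.PosDef) (hR : R.PosDef)
    (K : Matrix (Fin m) (Fin n) ℝ) (s : ℕ) :
    ∀ x, x ⬝ᵥ (riccatiIter A B Q R s *ᵥ x) ≤ ∑ j ∈ Finset.range (s + 1),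
      ((A - B * K) ^ j *ᵥ x) ⬝ᵥ ((Q + Kᵀ * R⁻¹ * K) *ᵥ ((A - B * K) ^ j *ᵥ x)) := by
  have hW : ∀ x, x ⬝ᵥ ((Q + Kᵀ * R⁻¹ * K) *ᵥ x) =
      x ⬝ᵥ (Q *ᵥ x) + (K *ᵥ x) ⬝ᵥ (R⁻¹ *ᵥ (K *ᵥ x)) := fun x => by
    rw [Matrix.add_mulVec, dotProduct_add, mulVec_dotProduct_mulVec]
  induction s with
  | zero =>
    intro x
    simp only [zero_add, Finset.range_one, Finset.sum_singleton, pow_zero, Matrix.one_mulVec, hW]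
    have := quadratic_nonneg hR.inv.posSemidef (K *ᵥ x)
    rw [riccatiIter]
    linarith
  | succ s ih =>
    intro x
    -- Apply the feedback `u = -Kx` at the first step; the remaining cost is bounded by the
    -- induction hypothesis at the next state `(A - BK)x`.
    have h1 := quadratic_riccatiMap_le (A := A) (B := B) (Q := Q) hR
      (posDef_riccatiIter (A := A) (B := B) hQ hR s) x (-(K *ᵥ x))
    have h2 : A *ᵥ x + B *ᵥ (-(K *ᵥ x)) = (A - B * K) *ᵥ x := by
      rw [Matrix.mulVec_neg, Matrix.mulVec_mulVec, ← sub_eq_add_neg, ← Matrix.sub_mulVec]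
    have h3 := ih ((A - B * K) *ᵥ x)
    rw [h2] at h1
    rw [Finset.sum_range_succ', pow_zero, Matrix.one_mulVec, hW]
    simp only [Matrix.mulVec_mulVec, ← pow_succ, Matrix.mulVec_neg, dotProduct_neg,
      neg_dotProduct, neg_neg] at h1 h3 ⊢
    rw [riccatiIter]
    linarith

end Riccati

-- Stability and convergence of the Riccati iteration

attribute [local instance] Matrix.linftyOpNormedAddCommGroup Matrix.linftyOpNormedSpace
  Matrix.linftyOpNormedRing Matrix.linftyOpNormedAlgebra in
/-- Powers of a matrix of spectral radius below one decay geometrically. -/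
lemma exists_norm_pow_le_of_spectralRadius_lt_one {k : ℕ} {M : Matrix (Fin k) (Fin k) ℂ}
    (h : spectralRadius ℂ M < 1) :
    ∃ r : ℝ, 0 ≤ r ∧ r < 1 ∧ ∀ᶠ j : ℕ in atTop, ∀ i l, ‖(M ^ j) i l‖ ≤ r ^ j := by
  obtain ⟨r, hr, hr1⟩ := ENNReal.lt_iff_exists_nnreal_btwn.mp h
  refine ⟨r, r.2, by exact_mod_cast hr1, ?_⟩
  -- Gelfand's formula: the `j`-th roots of the norms of `M ^ j` tend to the spectral radius, hence
  -- eventually lie below `r`.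
  have ht := spectrum.pow_nnnorm_pow_one_div_tendsto_nhds_spectralRadius M
  filter_upwards [ht.eventually_lt_const hr, eventually_gt_atTop 0] with j hj hj0 i l
  have h1 : (‖M ^ j‖₊ : ENNReal) ≤ (r : ENNReal) ^ j := by
    have := ENNReal.rpow_le_rpow hj.le (z := j) (by positivity)
    rwa [← ENNReal.rpow_mul, one_div, inv_mul_cancel₀ (by positivity), ENNReal.rpow_one,
      ENNReal.rpow_natCast] at this
  have h2 : ‖M ^ j‖ ≤ (r : ℝ) ^ j := by exact_mod_cast h1
  refine le_trans ?_ h2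
  rw [Matrix.linfty_opNorm_def]
  have h3 : ‖(M ^ j) i l‖₊ ≤ ∑ l, ‖(M ^ j) i l‖₊ :=
    Finset.single_le_sum (f := fun l => ‖(M ^ j) i l‖₊) (fun _ _ => zero_le) (Finset.mem_univ l)
  have h4 : ∑ l, ‖(M ^ j) i l‖₊ ≤ Finset.univ.sup fun i => ∑ l, ‖(M ^ j) i l‖₊ :=
    Finset.le_sup (f := fun i => ∑ l, ‖(M ^ j) i l‖₊) (Finset.mem_univ i)
  exact_mod_cast h3.trans h4

/-- The squared norms along a trajectory of a stable linear system are summable. -/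
lemma summable_pow_mulVec_dotProduct_self {k : ℕ} {M : Matrix (Fin k) (Fin k) ℝ}
    (h : spectralRadius ℂ (M.map (algebraMap ℝ ℂ)) < 1) (x : Fin k → ℝ) :
    Summable fun j : ℕ => (M ^ j *ᵥ x) ⬝ᵥ (M ^ j *ᵥ x) := by
  obtain ⟨r, hr0, hr1, hr⟩ := exists_norm_pow_le_of_spectralRadius_lt_one h
  have hg : Summable fun j : ℕ => (∑ _i : Fin k, (∑ l, |x l|) ^ 2) * (r ^ 2) ^ j :=
    (summable_geometric_of_lt_one (by positivity) (by nlinarith)).mul_left _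
  refine summable_of_isBigO_nat hg (Asymptotics.IsBigO.of_bound 1 ?_)
  filter_upwards [hr] with j hj
  have hent : ∀ i l, |(M ^ j) i l| ≤ r ^ j := fun i l => by
    have := hj i l
    rw [← Matrix.map_pow] at this
    simpa using this
  rw [Real.norm_of_nonneg (dotProduct_self_nonneg_real _), Real.norm_of_nonneg (by positivity), one_mul,
    dotProduct, Finset.sum_mul]
  refine Finset.sum_le_sum fun i _ => ?_
  have h1 : |(M ^ j *ᵥ x) i| ≤ (∑ l, |x l|) * r ^ j := by
    rw [Matrix.mulVec, dotProduct, Finset.sum_mul]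
    refine (Finset.abs_sum_le_sum_abs _ _).trans (Finset.sum_le_sum fun l _ => ?_)
    rw [abs_mul, mul_comm]
    exact mul_le_mul_of_nonneg_left (hent i l) (abs_nonneg _)
  calc (M ^ j *ᵥ x) i * (M ^ j *ᵥ x) i = |(M ^ j *ᵥ x) i| ^ 2 := by rw [sq_abs, pow_two]
    _ ≤ ((∑ l, |x l|) * r ^ j) ^ 2 := pow_le_pow_left₀ (abs_nonneg _) h1 2
    _ = _ := by ring

/-- Polarisation; it reduces entrywise convergence of symmetric matrices to convergence of quadratic
forms. -/
lemma apply_eq_quadratic {k : ℕ} {P : Matrix (Fin k) (Fin k) ℝ} (hP : Pᵀ = P) (i j : Fin k) :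
    P i j = ((Pi.single i 1 + Pi.single j 1) ⬝ᵥ (P *ᵥ (Pi.single i 1 + Pi.single j 1)) -
      Pi.single i 1 ⬝ᵥ (P *ᵥ Pi.single i 1) - Pi.single j 1 ⬝ᵥ (P *ᵥ Pi.single j 1)) / 2 := by
  rw [quadratic_add hP, dotProduct_mulVec_comm hP (Pi.single j 1)]
  have : (Pi.single i 1 : Fin k → ℝ) ⬝ᵥ (P *ᵥ Pi.single j 1) = P i j := by simp
  rw [this]
  ring

/-- Symmetric matrices converge as soon as their quadratic forms do. -/
lemma exists_tendsto_of_quadratic {k : ℕ} {P : ℕ → Matrix (Fin k) (Fin k) ℝ}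
    (hP : ∀ s, (P s)ᵀ = P s)
    (h : ∀ x, ∃ q, Tendsto (fun s => x ⬝ᵥ (P s *ᵥ x)) atTop (𝓝 q)) :
    ∃ P', Tendsto P atTop (𝓝 P') := by
  choose q hq using h
  refine ⟨Matrix.of fun i j => (q (Pi.single i 1 + Pi.single j 1) - q (Pi.single i 1) -
    q (Pi.single j 1)) / 2, ?_⟩
  refine tendsto_pi_nhds.mpr fun i => tendsto_pi_nhds.mpr fun j => ?_
  refine ((((hq (Pi.single i 1 + Pi.single j 1)).sub (hq (Pi.single i 1))).sub
    (hq (Pi.single j 1))).div_const 2).congr fun s => ?_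
  rw [← apply_eq_quadratic (hP s) i j]

/-- The Riccati iteration of a stabilizable pair converges to a fixed point. -/
lemma exists_tendsto_riccatiIter {n m : ℕ} {A : Matrix (Fin n) (Fin n) ℝ}
    {B : Matrix (Fin n) (Fin m) ℝ} {Q : Matrix (Fin n) (Fin n) ℝ} {R : Matrix (Fin m) (Fin m) ℝ}
    (hQ : Q.PosDef) (hR : R.PosDef) (hAB : Stabilizable A B) :
    ∃ P, P.PosDef ∧ Tendsto (riccatiIter A B Q R) atTop (𝓝 P) ∧ riccatiMap A B Q R P = P := by
  obtain ⟨K, hK⟩ := hAB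
  have hmono : ∀ x, Monotone fun s => x ⬝ᵥ (riccatiIter A B Q R s *ᵥ x) := fun x =>
    monotone_nat_of_le_succ fun s => quadratic_riccatiIter_le_succ hQ hR s x
  have hbdd : ∀ x, BddAbove (Set.range fun s => x ⬝ᵥ (riccatiIter A B Q R s *ᵥ x)) := by
    intro x
    obtain ⟨c, hc, hle⟩ := exists_abs_quadratic_le (Q + Kᵀ * R⁻¹ * K)
    -- An upper bound for the infinite-horizon cost of the feedback `K`, with `c` bounding the stage
    -- cost by the squared norm of the state.
    refine ⟨∑' j, c * (((A - B * K) ^ j *ᵥ x) ⬝ᵥ ((A - B * K) ^ j *ᵥ x)), ?_⟩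
    rintro _ ⟨s, rfl⟩
    refine (quadratic_riccatiIter_le_sum hQ hR K s x).trans ?_
    refine le_trans (Finset.sum_le_sum fun j _ => (le_abs_self _).trans (hle _)) ?_
    exact ((summable_pow_mulVec_dotProduct_self hK x).mul_left c).sum_le_tsum _
      fun j _ => mul_nonneg hc (dotProduct_self_nonneg_real _)
  have hsymm : ∀ s, (riccatiIter A B Q R s)ᵀ = riccatiIter A B Q R s := fun s =>
    PosDef.transpose_eq (posDef_riccatiIter hQ hR s)
  obtain ⟨P, hP⟩ := exists_tendsto_of_quadratic hsymm fun x =>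
    ⟨_, tendsto_atTop_ciSup (hmono x) (hbdd x)⟩
  have hquad : ∀ x, Tendsto (fun s => x ⬝ᵥ (riccatiIter A B Q R s *ᵥ x)) atTop
      (𝓝 (x ⬝ᵥ (P *ᵥ x))) := fun x => by
    have hc : Continuous fun X : Matrix (Fin n) (Fin n) ℝ => x ⬝ᵥ (X *ᵥ x) := by fun_prop
    exact (hc.tendsto P).comp hP
  have hPd : P.PosDef := by
    refine Matrix.PosDef.of_dotProduct_mulVec_pos ?_ fun x hx => ?_
    · have hc : Continuous fun X : Matrix (Fin n) (Fin n) ℝ => Xᵀ := by fun_prop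
      have h1 := (hc.tendsto P).comp hP
      have h2 : P = Pᵀ := tendsto_nhds_unique hP (h1.congr fun s => hsymm s)
      simpa [Matrix.IsHermitian] using h2.symm
    -- The increasing limit dominates the iterate at `0`, which is the positive definite `Q`.
    · have h1 := hQ.dotProduct_mulVec_pos hx
      simp only [star_trivial] at h1 ⊢
      exact h1.trans_le ((hmono x).ge_of_tendsto (hquad x) 0)
  refine ⟨P, hPd, hP, ?_⟩
  have hcont : ContinuousAt (riccatiMap A B Q R) P := by
    have h1 := continuousAt_inv_of_posDef hPd
    have h2 := continuousAt_inv_of_posDef (posDef_mul_mul_add_inv B hR hPd)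
    have h3 : ContinuousAt (fun X : Matrix (Fin n) (Fin n) ℝ => (B * R * Bᵀ + X⁻¹)⁻¹) P :=
      ContinuousAt.comp (f := fun X : Matrix (Fin n) (Fin n) ℝ => B * R * Bᵀ + X⁻¹)
        (g := fun X => X⁻¹) h2 (continuousAt_const.add h1)
    have h4 : Continuous fun X : Matrix (Fin n) (Fin n) ℝ => Q + Aᵀ * X * A := by fun_prop
    exact h4.continuousAt.comp h3
  -- The shifted iteration tends both to `riccatiMap A B Q R P` and to `P`.
  exact tendsto_nhds_unique (hcont.tendsto.comp hP) ((tendsto_add_atTop_iff_nat 1).mpr hP)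

/-! ### One backward step for Gaussian densities -/

/-- The logarithm of the ratio of a Gaussian density and an unnormalised Gaussian density. -/
lemma exists_gaussianPdf_log_ratio {k : ℕ} {S V N : Matrix (Fin k) (Fin k) ℝ} (hS : S.PosDef)
    (hV : V.PosDef) (hN : Nᵀ = N) {g : (Fin k → ℝ) → ℝ} {C : ℝ} (hC : 0 < C)
    (hg : ∀ x, g x = C * Real.exp (-(1 / 2) * (x ⬝ᵥ (N *ᵥ x)))) :
    ∃ c K : ℝ, 0 ≤ K ∧ ∀ μ,
      Integrable (fun x => gaussianPdf μ S x *
        Real.log (gaussianPdf μ S x / (g x * gaussianPdf 0 V x))) ∧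
      ∫ x, gaussianPdf μ S x * Real.log (gaussianPdf μ S x / (g x * gaussianPdf 0 V x)) =
        c + 1 / 2 * (μ ⬝ᵥ ((V⁻¹ + N) *ᵥ μ)) ∧
      ∀ x, |Real.log (gaussianPdf μ S x / (g x * gaussianPdf 0 V x))| ≤
        K * (1 + x ⬝ᵥ x + μ ⬝ᵥ μ) := by
  have hP : (V⁻¹ + N)ᵀ = V⁻¹ + N := by
    rw [Matrix.transpose_add, PosDef.transpose_eq hV.inv, hN]
  set κ := Real.log (Real.sqrt ((2 * Real.pi) ^ k * S.det))⁻¹ - Real.log C -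
    Real.log (Real.sqrt ((2 * Real.pi) ^ k * V.det))⁻¹ with hκ
  have hlog : ∀ μ x, Real.log (gaussianPdf μ S x / (g x * gaussianPdf 0 V x)) =
      κ - 1 / 2 * ((x - μ) ⬝ᵥ (S⁻¹ *ᵥ (x - μ))) + 1 / 2 * (x ⬝ᵥ ((V⁻¹ + N) *ᵥ x)) := by
    intro μ x
    have h1 := gaussianPdf_const_pos hS
    have h2 := gaussianPdf_const_pos hV
    rw [hg, gaussianPdf, gaussianPdf, Real.log_div (by positivity) (by positivity),
      Real.log_mul (by positivity) (by positivity), Real.log_mul (by positivity) (by positivity),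
      Real.log_mul (by positivity) (by positivity), Real.log_mul (by positivity) (by positivity),
      Real.log_exp, Real.log_exp, Real.log_exp, sub_zero, hκ, Matrix.add_mulVec, dotProduct_add]
    ring
  obtain ⟨K₁, hK₁, h₁⟩ := exists_abs_quadratic_le S⁻¹
  obtain ⟨K₂, hK₂, h₂⟩ := exists_abs_quadratic_le (V⁻¹ + N)
  obtain ⟨c₁, hc₁⟩ := exists_integral_gaussianPdf_mul_quadratic hS
    (PosDef.transpose_eq hS.inv)
  obtain ⟨c₂, hc₂⟩ := exists_integral_gaussianPdf_mul_quadratic hS hP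
  -- `κ` collects the normalising constants and `log C`; `c₁` and `c₂` are the centred expectations
  -- of the forms of `S⁻¹` and `V⁻¹ + N`.
  refine ⟨κ - 1 / 2 * c₁ + 1 / 2 * c₂, |κ| + K₁ + K₂, by positivity, fun μ => ?_⟩
  have hbound : ∀ x, |Real.log (gaussianPdf μ S x / (g x * gaussianPdf 0 V x))| ≤
      (|κ| + K₁ + K₂) * (1 + x ⬝ᵥ x + μ ⬝ᵥ μ) := by
    intro x
    rw [hlog]
    have e1 := h₁ (x - μ)
    have e2 := h₂ x
    have e3 := add_dotProduct_self_le x (-μ)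
    simp only [← sub_eq_add_neg, neg_dotProduct, dotProduct_neg, neg_neg] at e3
    have e4 := dotProduct_self_nonneg_real x
    have e5 := dotProduct_self_nonneg_real μ
    have e6 : K₁ * ((x - μ) ⬝ᵥ (x - μ)) ≤ K₁ * (2 * (x ⬝ᵥ x) + 2 * (μ ⬝ᵥ μ)) :=
      mul_le_mul_of_nonneg_left e3 hK₁
    have e7 : 0 ≤ K₂ * (μ ⬝ᵥ μ) := by positivity
    have e8 : 0 ≤ |κ| * (x ⬝ᵥ x + μ ⬝ᵥ μ) := by positivity
    rw [abs_le] at e1 e2 ⊢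
    have e9 := le_abs_self κ
    have e10 := neg_abs_le κ
    have e11 : 0 ≤ K₂ * (x ⬝ᵥ x) := by positivity
    constructor <;> nlinarith
  have i1 : Integrable (fun x => gaussianPdf μ S x * ((x - μ) ⬝ᵥ (S⁻¹ *ᵥ (x - μ)))) := by
    have := (integrable_gaussianPdf_mul_of_le hS 0 (g := fun x => x ⬝ᵥ (S⁻¹ *ᵥ x)) (by fun_prop)
      (K := K₁) fun x => (h₁ x).trans (by nlinarith)).comp_sub_right μ
    simpa only [← gaussianPdf_eq_sub] using this
  have e1 : ∫ x, gaussianPdf μ S x * ((x - μ) ⬝ᵥ (S⁻¹ *ᵥ (x - μ))) = c₁ := by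
    have := integral_sub_right_eq_self (μ := volume)
      (fun x => gaussianPdf 0 S x * (x ⬝ᵥ (S⁻¹ *ᵥ x))) μ
    simp only [← gaussianPdf_eq_sub] at this
    rw [this, hc₁]
    simp
  have i2 : Integrable (fun x => gaussianPdf μ S x * (x ⬝ᵥ ((V⁻¹ + N) *ᵥ x))) :=
    integrable_gaussianPdf_mul_of_le hS μ (by fun_prop) (K := K₂)
      fun x => (h₂ x).trans (by nlinarith)
  have i0 := (integrable_gaussianPdf hS μ).mul_const κ
  have hexp : ∀ x, gaussianPdf μ S x *
      Real.log (gaussianPdf μ S x / (g x * gaussianPdf 0 V x)) =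
      gaussianPdf μ S x * κ - 1 / 2 * (gaussianPdf μ S x * ((x - μ) ⬝ᵥ (S⁻¹ *ᵥ (x - μ)))) +
        1 / 2 * (gaussianPdf μ S x * (x ⬝ᵥ ((V⁻¹ + N) *ᵥ x))) := fun x => by
    rw [hlog]
    ring
  have i3 : Integrable fun x => gaussianPdf μ S x * κ -
      1 / 2 * (gaussianPdf μ S x * ((x - μ) ⬝ᵥ (S⁻¹ *ᵥ (x - μ)))) := i0.sub (i1.const_mul _)
  refine ⟨?_, ?_, hbound⟩
  · simp only [hexp]
    exact i3.add (i2.const_mul _)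
  · simp only [hexp]
    rw [integral_add i3 (i2.const_mul _), integral_sub i0 (i1.const_mul _), integral_mul_const,
      integral_const_mul, integral_const_mul, e1, hc₂, integral_gaussianPdf hS]
    ring

/-- A Gaussian density times the exponential of a quadratic form is an unnormalised
Gaussian density. -/
lemma exists_gaussianPdf_mul_exp_eq {n m : ℕ} {R : Matrix (Fin m) (Fin m) ℝ}
    {P : Matrix (Fin n) (Fin n) ℝ} (B : Matrix (Fin n) (Fin m) ℝ) (hR : R.PosDef)
    (hP : P.PosDef) (c : ℝ) :
    ∃ C : ℝ, 0 < C ∧ ∀ y u,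
      gaussianPdf 0 R u *
          Real.exp (-(c + 1 / 2 * ((y + B *ᵥ u) ⬝ᵥ (P *ᵥ (y + B *ᵥ u))))) =
        C * Real.exp (-(1 / 2) * (y ⬝ᵥ ((B * R * Bᵀ + P⁻¹)⁻¹ *ᵥ y))) *
          gaussianPdf (-((R⁻¹ + Bᵀ * P * B)⁻¹ *ᵥ ((Bᵀ * P) *ᵥ y)))
            (R⁻¹ + Bᵀ * P * B)⁻¹ u := by
  have hW := posDef_inv_add B hR hP
  have := hW.isUnit.invertible
  have h1 := gaussianPdf_const_pos hR
  have h2 := gaussianPdf_const_pos hW.inv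
  -- Ratio of the two normalising constants times `exp(-c)`. It is free of `y` because the
  -- covariance of the resulting Gaussian is.
  refine ⟨(Real.sqrt ((2 * Real.pi) ^ m * R.det))⁻¹ * Real.exp (-c) *
    ((Real.sqrt ((2 * Real.pi) ^ m * ((R⁻¹ + Bᵀ * P * B)⁻¹).det))⁻¹)⁻¹, by positivity,
    fun y u => ?_⟩
  have h3 := complete_square B hR hP y u
  rw [gaussianPdf, gaussianPdf, sub_zero, sub_neg_eq_add, Matrix.inv_inv_of_invertible]
  have h4 : ∀ a b e f g : ℝ, e ≠ 0 → a * b * e⁻¹ * f * (e * g) = a * (b * f * g) := by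
    intro a b e f g he
    field_simp
  rw [h4 _ _ _ _ _ h2.ne', ← Real.exp_add, ← Real.exp_add, mul_assoc, ← Real.exp_add]
  congr 2
  linarith

/-! ### The backward recursion of a stationary problem -/

namespace GaussianProblem

variable {n m : ℕ}

/-- The problem is time invariant with centred ideal densities. -/
structure IsStationary (D : GaussianProblem n m) (A : Matrix (Fin n) (Fin n) ℝ)
    (B : Matrix (Fin n) (Fin m) ℝ) (Ix : Matrix (Fin n) (Fin n) ℝ)
    (Iu : Matrix (Fin m) (Fin m) ℝ) : Prop where
  A_eq : ∀ t, 1 ≤ t → D.A t = A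
  B_eq : ∀ t, 1 ≤ t → D.B t = B
  noiseCov_posDef : ∀ t, 1 ≤ t → (D.noiseCov t).PosDef
  idealCovX_eq : ∀ t, 1 ≤ t → D.idealCovX t = Ix
  idealCovU_eq : ∀ t, 1 ≤ t → D.idealCovU t = Iu
  idealMeanX_eq : ∀ t, 1 ≤ t → D.idealMeanX t = 0
  idealMeanU_eq : ∀ t, 1 ≤ t → D.idealMeanU t = 0
  posDef_x : Ix.PosDef
  posDef_u : Iu.PosDef

namespace IsStationary

variable {D : GaussianProblem n m} {A : Matrix (Fin n) (Fin n) ℝ}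
  {B : Matrix (Fin n) (Fin m) ℝ} {Ix : Matrix (Fin n) (Fin n) ℝ} {Iu : Matrix (Fin m) (Fin m) ℝ}

lemma posDef_iter (hD : D.IsStationary A B Ix Iu) (s : ℕ) :
    (riccatiIter A B Ix⁻¹ Iu s).PosDef :=
  posDef_riccatiIter hD.posDef_x.inv hD.posDef_u s

lemma paramsToGo_M (hD : D.IsStationary A B Ix Iu) (s t : ℕ) : (D.paramsToGo s t).M = 0 := by
  induction s generalizing t with
  | zero => rfl
  | succ s ih =>
    simp [paramsToGo, omegaMeanOf, ih, hD.idealMeanX_eq (t + 1) (by omega),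
      hD.idealMeanU_eq (t + 1) (by omega)]

/-- By time invariance only the number `s` of remaining steps matters. The terminal values `L = 0`
and `prec = 0` make the iteration start at `Ix⁻¹`. -/
lemma omegaPrecOf_paramsToGo (hD : D.IsStationary A B Ix Iu) (s t : ℕ) (ht : 1 ≤ t) :
    D.omegaPrecOf t (D.paramsToGo s t) = riccatiIter A B Ix⁻¹ Iu s := by
  induction s generalizing t with
  | zero => simp [paramsToGo, omegaPrecOf, riccatiIter, hD.idealCovX_eq t ht]
  | succ s ih =>
    rw [riccatiIter, riccatiMap, omegaPrecOf, paramsToGo]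
    simp only [ih (t + 1) (by omega), hD.idealCovX_eq t ht, hD.A_eq (t + 1) (by omega),
      hD.B_eq (t + 1) (by omega), hD.idealCovU_eq (t + 1) (by omega)]

/-- Before the horizon the parameters have this uniform shape; only the terminal ones, where `L = 0`
instead of `A`, differ. -/
lemma paramsToGo_succ (hD : D.IsStationary A B Ix Iu) (s t : ℕ) :
    D.paramsToGo (s + 1) t = ⟨A, 0, (B * Iu * Bᵀ + (riccatiIter A B Ix⁻¹ Iu s)⁻¹)⁻¹⟩ := by
  have h1 := hD.paramsToGo_M (s + 1) t
  have h2 : (D.paramsToGo (s + 1) t).L = A := by simp [paramsToGo, hD.A_eq (t + 1) (by omega)]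
  have h3 : (D.paramsToGo (s + 1) t).prec =
      (B * Iu * Bᵀ + (riccatiIter A B Ix⁻¹ Iu s)⁻¹)⁻¹ := by
    simp [paramsToGo, hD.B_eq (t + 1) (by omega), hD.idealCovU_eq (t + 1) (by omega),
      hD.omegaPrecOf_paramsToGo s (t + 1) (by omega)]
  calc D.paramsToGo (s + 1) t = ⟨(D.paramsToGo (s + 1) t).L, (D.paramsToGo (s + 1) t).M,
        (D.paramsToGo (s + 1) t).prec⟩ := rfl
    _ = _ := by rw [h1, h2, h3]

lemma paramsToGo_prec_transpose (hD : D.IsStationary A B Ix Iu) (s t : ℕ) :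
    (D.paramsToGo s t).precᵀ = (D.paramsToGo s t).prec := by
  cases s with
  | zero => simp [paramsToGo]
  | succ s =>
    rw [hD.paramsToGo_succ]
    exact PosDef.transpose_eq (posDef_mul_mul_add_inv B hD.posDef_u (hD.posDef_iter s)).inv

lemma policyCovOf_paramsToGo (hD : D.IsStationary A B Ix Iu) (s t : ℕ) (ht : 1 ≤ t) :
    D.policyCovOf t (D.paramsToGo s t) =
      (Iu⁻¹ + Bᵀ * riccatiIter A B Ix⁻¹ Iu s * B)⁻¹ := by
  rw [policyCovOf, hD.omegaPrecOf_paramsToGo s t ht, hD.B_eq t ht, hD.idealCovU_eq t ht]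

lemma policyMeanOf_paramsToGo (hD : D.IsStationary A B Ix Iu) (s t : ℕ) (ht : 1 ≤ t)
    (x : Fin n → ℝ) :
    D.policyMeanOf t (D.paramsToGo s t) x =
      -((Iu⁻¹ + Bᵀ * riccatiIter A B Ix⁻¹ Iu s * B)⁻¹ *ᵥ
        ((Bᵀ * riccatiIter A B Ix⁻¹ Iu s) *ᵥ (A *ᵥ x))) := by
  rw [policyMeanOf, hD.policyCovOf_paramsToGo s t ht, omegaMeanOf,
    hD.omegaPrecOf_paramsToGo s t ht, hD.B_eq t ht, hD.A_eq t ht, hD.idealMeanX_eq t ht,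
    hD.idealMeanU_eq t ht, hD.paramsToGo_M]
  simp [Matrix.mulVec_neg]

/-- The logarithm inside the definition of `ω`. -/
lemma exists_step_of_gamma (hD : D.IsStationary A B Ix Iu) {s t : ℕ} (ht : 1 ≤ t) {C : ℝ}
    (hC : 0 < C) (hg : ∀ x, D.gammaToGo s t x = C * Real.exp (-(1 / 2) *
      (((D.paramsToGo s t).L *ᵥ x + (D.paramsToGo s t).M) ⬝ᵥ
        ((D.paramsToGo s t).prec *ᵥ ((D.paramsToGo s t).L *ᵥ x + (D.paramsToGo s t).M))))) :
    ∃ c K : ℝ, 0 ≤ K ∧ ∀ x u,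
      Integrable (D.omegaIntegrand t (D.gammaToGo s t) x u) ∧
      ∫ x', D.omegaIntegrand t (D.gammaToGo s t) x u x' =
        c + 1 / 2 * ((A *ᵥ x + B *ᵥ u) ⬝ᵥ
          (riccatiIter A B Ix⁻¹ Iu s *ᵥ (A *ᵥ x + B *ᵥ u))) ∧
      ∀ x', |Real.log (D.modelPdf t x u x' / (D.gammaToGo s t x' * D.idealStatePdf t x'))| ≤
        K * (1 + x' ⬝ᵥ x' + (A *ᵥ x + B *ᵥ u) ⬝ᵥ (A *ᵥ x + B *ᵥ u)) := by
  have hN : ((D.paramsToGo s t).Lᵀ * (D.paramsToGo s t).prec * (D.paramsToGo s t).L)ᵀ =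
      (D.paramsToGo s t).Lᵀ * (D.paramsToGo s t).prec * (D.paramsToGo s t).L := by
    simp only [Matrix.transpose_mul, Matrix.transpose_transpose, hD.paramsToGo_prec_transpose,
      Matrix.mul_assoc]
  have hg' : ∀ x, D.gammaToGo s t x = C * Real.exp (-(1 / 2) * (x ⬝ᵥ
      (((D.paramsToGo s t).Lᵀ * (D.paramsToGo s t).prec * (D.paramsToGo s t).L) *ᵥ x))) := by
    intro x
    rw [hg, hD.paramsToGo_M, add_zero, mulVec_dotProduct_mulVec]
  obtain ⟨c, K, hK, h⟩ := exists_gaussianPdf_log_ratio (hD.noiseCov_posDef t ht) hD.posDef_x hN hC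
    hg'
  have hP := hD.omegaPrecOf_paramsToGo s t ht
  rw [omegaPrecOf, hD.idealCovX_eq t ht] at hP
  rw [hP] at h
  refine ⟨c, K, hK, fun x u => ?_⟩
  have := h (A *ᵥ x + B *ᵥ u)
  change Integrable (fun x' => D.omegaIntegrand t (D.gammaToGo s t) x u x') ∧ _
  simpa only [omegaIntegrand, modelPdf, idealStatePdf, hD.A_eq t ht, hD.B_eq t ht,
    hD.idealMeanX_eq t ht, hD.idealCovX_eq t ht] using this

/-- The induction step for `γ`: the dependence on `u` is a normalised Gaussian, so integrating over
`u` leaves exactly the factor in front, and normalising leaves exactly the Gaussian. -/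
lemma exists_control_eq (hD : D.IsStationary A B Ix Iu) {s t : ℕ} (ht : 1 ≤ t) {C : ℝ}
    (hC : 0 < C) (hg : ∀ x, D.gammaToGo s t x = C * Real.exp (-(1 / 2) *
      (((D.paramsToGo s t).L *ᵥ x + (D.paramsToGo s t).M) ⬝ᵥ
        ((D.paramsToGo s t).prec *ᵥ ((D.paramsToGo s t).L *ᵥ x + (D.paramsToGo s t).M))))) :
    ∃ C' : ℝ, 0 < C' ∧ ∀ x u, D.idealControlPdf t u *
        Real.exp (-∫ x', D.omegaIntegrand t (D.gammaToGo s t) x u x') =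
      C' * Real.exp (-(1 / 2) * ((A *ᵥ x) ⬝ᵥ
        ((B * Iu * Bᵀ + (riccatiIter A B Ix⁻¹ Iu s)⁻¹)⁻¹ *ᵥ (A *ᵥ x)))) *
        gaussianPdf (D.policyMeanOf t (D.paramsToGo s t) x)
          (D.policyCovOf t (D.paramsToGo s t)) u := by
  obtain ⟨c, K, -, h⟩ := hD.exists_step_of_gamma ht hC hg
  obtain ⟨C', hC', h'⟩ := exists_gaussianPdf_mul_exp_eq B hD.posDef_u (hD.posDef_iter s) c
  refine ⟨C', hC', fun x u => ?_⟩
  rw [(h x u).2.1, hD.policyMeanOf_paramsToGo s t ht, hD.policyCovOf_paramsToGo s t ht, ← h',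
    idealControlPdf, hD.idealMeanU_eq t ht, hD.idealCovU_eq t ht]

lemma posDef_policyCovOf (hD : D.IsStationary A B Ix Iu) (s t : ℕ) (ht : 1 ≤ t) :
    (D.policyCovOf t (D.paramsToGo s t)).PosDef := by
  rw [hD.policyCovOf_paramsToGo s t ht]
  exact (posDef_inv_add B hD.posDef_u (hD.posDef_iter s)).inv

/-- The functions `γ` are unnormalised Gaussian densities. -/
lemma exists_gammaToGo_eq (hD : D.IsStationary A B Ix Iu) (s t : ℕ) :
    ∃ C : ℝ, 0 < C ∧ ∀ x, D.gammaToGo s t x = C * Real.exp (-(1 / 2) *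
      (((D.paramsToGo s t).L *ᵥ x + (D.paramsToGo s t).M) ⬝ᵥ
        ((D.paramsToGo s t).prec *ᵥ ((D.paramsToGo s t).L *ᵥ x + (D.paramsToGo s t).M)))) := by
  induction s generalizing t with
  | zero => exact ⟨1, one_pos, fun x => by simp [gammaToGo, paramsToGo]⟩
  | succ s ih =>
    obtain ⟨C, hC, hg⟩ := ih (t + 1)
    obtain ⟨C', hC', h⟩ := hD.exists_control_eq (by omega) hC hg
    refine ⟨C', hC', fun x => ?_⟩
    rw [gammaToGo]
    simp only [h]
    rw [integral_const_mul, integral_gaussianPdf (hD.posDef_policyCovOf s (t + 1) (by omega)),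
      mul_one, hD.paramsToGo_succ, add_zero]

lemma gammaToGo_pos (hD : D.IsStationary A B Ix Iu) (s t : ℕ) (x : Fin n → ℝ) :
    0 < D.gammaToGo s t x := by
  obtain ⟨C, hC, h⟩ := hD.exists_gammaToGo_eq s t
  rw [h]
  positivity

/-- The numerator of the optimal strategy, in terms of its normalisation. -/
lemma idealControlPdf_mul_exp (hD : D.IsStationary A B Ix Iu) (s t : ℕ) (x : Fin n → ℝ)
    (u : Fin m → ℝ) :
    D.idealControlPdf (t + 1) u *
        Real.exp (-∫ x', D.omegaIntegrand (t + 1) (D.gammaToGo s (t + 1)) x u x') =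
      D.gammaToGo (s + 1) t x * gaussianPdf (D.policyMeanOf (t + 1) (D.paramsToGo s (t + 1)) x)
          (D.policyCovOf (t + 1) (D.paramsToGo s (t + 1))) u := by
  obtain ⟨C, hC, hg⟩ := hD.exists_gammaToGo_eq s (t + 1)
  obtain ⟨C', hC', h⟩ := hD.exists_control_eq (by omega) hC hg
  rw [h, gammaToGo]
  simp only [h]
  rw [integral_const_mul, integral_gaussianPdf (hD.posDef_policyCovOf s (t + 1) (by omega)),
    mul_one]

/-- The optimal strategy is Gaussian. -/
lemma controlPdf_eq (hD : D.IsStationary A B Ix Iu) {T t : ℕ} (ht : 1 ≤ t) (htT : t ≤ T)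
    (x : Fin n → ℝ) (u : Fin m → ℝ) :
    D.controlPdf T t x u = gaussianPdf (D.policyMean T t x) (D.policyCov T t) u := by
  obtain ⟨t, rfl⟩ : ∃ k, t = k + 1 := ⟨t - 1, by omega⟩
  -- The normaliser `γ` at the previous time has one more step to go than the `γ` inside `ω`. With
  -- truncated subtraction this needs `t + 1 ≤ T`.
  have h1 : T - (t + 1 - 1) = (T - (t + 1)) + 1 := by omega
  rw [controlPdf, omegaFn, gammaFn, gammaFn, h1, hD.idealControlPdf_mul_exp,
    show t + 1 - 1 = t from rfl, mul_div_cancel_left₀ _ (hD.gammaToGo_pos _ _ _).ne']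
  rfl

lemma integrable_idealControlPdf_mul_exp (hD : D.IsStationary A B Ix Iu) {T t : ℕ} (ht : 1 ≤ t)
    (x : Fin n → ℝ) :
    Integrable fun u => D.idealControlPdf t u * Real.exp (-D.omegaFn T t x u) := by
  obtain ⟨t, rfl⟩ : ∃ k, t = k + 1 := ⟨t - 1, by omega⟩
  simp only [omegaFn, gammaFn, hD.idealControlPdf_mul_exp]
  exact (integrable_gaussianPdf (hD.posDef_policyCovOf _ _ ht) _).const_mul _

lemma integrable_omegaIntegrand (hD : D.IsStationary A B Ix Iu) {T t : ℕ} (ht : 1 ≤ t)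
    (x : Fin n → ℝ) (u : Fin m → ℝ) :
    Integrable (D.omegaIntegrand t (D.gammaFn T t) x u) := by
  obtain ⟨C, hC, hg⟩ := hD.exists_gammaToGo_eq (T - t) t
  obtain ⟨c, K, -, h⟩ := hD.exists_step_of_gamma ht hC hg
  exact (h x u).1

end IsStationary

end GaussianProblem

/-! ### The Kullback–Leibler divergence of densities and the entropy inequality -/

section Divergence

variable {α : Type*} [MeasureSpace α] {f₁ f₂ : α → ℝ}

lemma isProbabilityMeasure_withDensity_ofReal (h₁ : ∀ a, 0 ≤ f₁ a) (i₁ : ∫ a, f₁ a = 1) :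
    IsProbabilityMeasure ((volume : Measure α).withDensity fun a => ENNReal.ofReal (f₁ a)) := by
  refine ⟨?_⟩
  rw [withDensity_apply _ MeasurableSet.univ, Measure.restrict_univ,
    ← ofReal_integral_eq_lintegral_ofReal (Integrable.of_integral_ne_zero (by simp [i₁]))
      (ae_of_all _ h₁), i₁, ENNReal.ofReal_one]

/-- Positivity of `f₂` makes `f₁ / f₂` the Radon–Nikodym derivative, which gives absolute continuity
and identifies the abstract log-likelihood ratio. -/
lemma withDensity_ofReal_eq (m₁ : Measurable f₁) (m₂ : Measurable f₂)
    (h₂ : ∀ a, 0 < f₂ a) :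
    (volume : Measure α).withDensity (fun a => ENNReal.ofReal (f₁ a)) =
      ((volume : Measure α).withDensity fun a => ENNReal.ofReal (f₂ a)).withDensity
        fun a => ENNReal.ofReal (f₁ a / f₂ a) := by
  have hd : Measurable fun a => f₁ a / f₂ a := m₁.div m₂
  rw [← withDensity_mul _ m₂.ennreal_ofReal hd.ennreal_ofReal]
  congr 1
  funext a
  rw [Pi.mul_apply, ← ENNReal.ofReal_mul (h₂ a).le, mul_div_cancel₀ _ (h₂ a).ne']

lemma withDensity_ofReal_absolutelyContinuous (m₁ : Measurable f₁) (m₂ : Measurable f₂)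
    (h₂ : ∀ a, 0 < f₂ a) :
    (volume : Measure α).withDensity (fun a => ENNReal.ofReal (f₁ a)) ≪
      (volume : Measure α).withDensity fun a => ENNReal.ofReal (f₂ a) := by
  rw [withDensity_ofReal_eq m₁ m₂ h₂]
  exact withDensity_absolutelyContinuous _ _

lemma llr_withDensity_ofReal (m₁ : Measurable f₁) (m₂ : Measurable f₂) (h₁ : ∀ a, 0 ≤ f₁ a)
    (h₂ : ∀ a, 0 < f₂ a) (i₂ : ∫ a, f₂ a = 1) :
    llr ((volume : Measure α).withDensity fun a => ENNReal.ofReal (f₁ a))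
        ((volume : Measure α).withDensity fun a => ENNReal.ofReal (f₂ a))
      =ᵐ[(volume : Measure α).withDensity fun a => ENNReal.ofReal (f₁ a)]
        fun a => Real.log (f₁ a / f₂ a) := by
  have := isProbabilityMeasure_withDensity_ofReal (fun a => (h₂ a).le) i₂
  have h := Measure.rnDeriv_withDensity
    ((volume : Measure α).withDensity fun a => ENNReal.ofReal (f₂ a)) (m₁.div m₂).ennreal_ofReal
  simp only [Pi.div_apply] at h
  rw [← withDensity_ofReal_eq m₁ m₂ h₂] at h
  filter_upwards [(withDensity_ofReal_absolutelyContinuous m₁ m₂ h₂).ae_le h] with a ha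
  rw [llr, ha, ENNReal.toReal_ofReal (div_nonneg (h₁ a) (h₂ a).le)]

lemma klDivPdf_ne_top_iff (m₁ : Measurable f₁) (m₂ : Measurable f₂) (h₁ : ∀ a, 0 ≤ f₁ a)
    (h₂ : ∀ a, 0 < f₂ a) (i₂ : ∫ a, f₂ a = 1) :
    klDivPdf f₁ f₂ ≠ ⊤ ↔ Integrable fun a => f₁ a * Real.log (f₁ a / f₂ a) := by
  rw [klDivPdf, InformationTheory.klDiv_ne_top_iff,
    integrable_congr (llr_withDensity_ofReal m₁ m₂ h₁ h₂ i₂),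
    integrable_withDensity_iff_integrable_smul' m₁.ennreal_ofReal (ae_of_all _ fun a => by simp)]
  simp only [ENNReal.toReal_ofReal (h₁ _), smul_eq_mul]
  exact and_iff_right (withDensity_ofReal_absolutelyContinuous m₁ m₂ h₂)

/-- Equal total masses remove the mass correction in `klDiv`. Integrability is not needed: without
it the divergence is `⊤`, and both sides are `0` by convention. -/
lemma toReal_klDivPdf (m₁ : Measurable f₁) (m₂ : Measurable f₂) (h₁ : ∀ a, 0 ≤ f₁ a)
    (h₂ : ∀ a, 0 < f₂ a) (i₁ : ∫ a, f₁ a = 1) (i₂ : ∫ a, f₂ a = 1) :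
    (klDivPdf f₁ f₂).toReal = ∫ a, f₁ a * Real.log (f₁ a / f₂ a) := by
  have p₁ := isProbabilityMeasure_withDensity_ofReal h₁ i₁
  have p₂ := isProbabilityMeasure_withDensity_ofReal (fun a => (h₂ a).le) i₂
  rw [klDivPdf, InformationTheory.toReal_klDiv_of_measure_eq
      (withDensity_ofReal_absolutelyContinuous m₁ m₂ h₂) (by simp),
    integral_congr_ae (llr_withDensity_ofReal m₁ m₂ h₁ h₂ i₂),
    integral_withDensity_eq_integral_toReal_smul m₁.ennreal_ofReal (ae_of_all _ fun a => by simp)]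
  simp only [ENNReal.toReal_ofReal (h₁ _), smul_eq_mul]

/-- Gibbs' inequality for densities. -/
lemma integral_mul_log_div_nonneg (m₁ : Measurable f₁) (m₂ : Measurable f₂) (h₁ : ∀ a, 0 ≤ f₁ a)
    (h₂ : ∀ a, 0 < f₂ a) (i₁ : ∫ a, f₁ a = 1) (i₂ : ∫ a, f₂ a = 1) :
    0 ≤ ∫ a, f₁ a * Real.log (f₁ a / f₂ a) := by
  rw [← toReal_klDivPdf m₁ m₂ h₁ h₂ i₁ i₂]
  exact ENNReal.toReal_nonneg

/-- The equality case of Gibbs' inequality for densities. -/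
lemma ae_eq_of_integral_mul_log_div_eq_zero (m₁ : Measurable f₁) (m₂ : Measurable f₂)
    (h₁ : ∀ a, 0 ≤ f₁ a) (h₂ : ∀ a, 0 < f₂ a) (i₁ : ∫ a, f₁ a = 1) (i₂ : ∫ a, f₂ a = 1)
    (hi : Integrable fun a => f₁ a * Real.log (f₁ a / f₂ a))
    (h : ∫ a, f₁ a * Real.log (f₁ a / f₂ a) ≤ 0) : f₁ =ᵐ[volume] f₂ := by
  have p₁ := isProbabilityMeasure_withDensity_ofReal h₁ i₁
  have p₂ := isProbabilityMeasure_withDensity_ofReal (fun a => (h₂ a).le) i₂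
  have ht := (klDivPdf_ne_top_iff m₁ m₂ h₁ h₂ i₂).mpr hi
  have h0 : klDivPdf f₁ f₂ = 0 := by
    rw [← toReal_klDivPdf m₁ m₂ h₁ h₂ i₁ i₂] at h
    exact ((ENNReal.toReal_eq_zero_iff _).mp (le_antisymm h ENNReal.toReal_nonneg)).resolve_right ht
  rw [klDivPdf, InformationTheory.klDiv_eq_zero_iff, withDensity_eq_iff
    m₁.ennreal_ofReal.aemeasurable m₂.ennreal_ofReal.aemeasurable] at h0
  · filter_upwards [h0] with a ha
    rwa [ENNReal.ofReal_eq_ofReal_iff (h₁ a) (h₂ a).le] at ha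
  · have := p₁.measure_univ
    rw [withDensity_apply _ MeasurableSet.univ, Measure.restrict_univ] at this
    simp [this]

/-- A finite divergence controls the expectation of functions with an exponential moment. -/
lemma integrable_mul_of_integrable_exp (m₁ : Measurable f₁) (h₁ : ∀ a, 0 ≤ f₁ a)
    (h₂ : ∀ a, 0 < f₂ a) (i₁ : Integrable f₁) {g : α → ℝ} (hg : Measurable g) (hg0 : ∀ a, 0 ≤ g a)
    (hi : Integrable fun a => f₁ a * Real.log (f₁ a / f₂ a))
    (he : Integrable fun a => f₂ a * Real.exp (g a)) : Integrable fun a => f₁ a * g a := by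
  refine ((hi.sub i₁).add he).mono' (m₁.mul hg).aestronglyMeasurable (ae_of_all _ fun a => ?_)
  simp only [Pi.add_apply, Pi.sub_apply]
  rw [Real.norm_of_nonneg (mul_nonneg (h₁ a) (hg0 a))]
  rcases (h₁ a).eq_or_lt with h | h
  · rw [← h]
    have := mul_pos (h₂ a) (Real.exp_pos (g a))
    simp [this.le]
  -- The inequality `a + 1 ≤ exp a` at `a = g - log(f₁/f₂)`, multiplied by `f₁`, reads `f₁ g ≤ f₁
  -- log(f₁/f₂) - f₁ + f₂ exp g`. The right-hand side is the integrable majorant.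
  · have h3 := Real.add_one_le_exp (g a - Real.log (f₁ a / f₂ a))
    rw [Real.exp_sub, Real.exp_log (div_pos h (h₂ a)), le_div_iff₀ (div_pos h (h₂ a))] at h3
    have h4 := mul_le_mul_of_nonneg_left h3 (h₂ a).le
    have h5 : f₂ a * ((g a - Real.log (f₁ a / f₂ a) + 1) * (f₁ a / f₂ a)) =
        (g a - Real.log (f₁ a / f₂ a) + 1) * f₁ a := by
      have := (h₂ a).ne'
      field_simp
    linarith

end Divergence

/-! ### Integration over trajectories -/

/-- Integrability of a function times a nonnegative kernel. -/
lemma integrable_mul_kernel {α β : Type*} [MeasureSpace α] [MeasureSpace β]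
    [SFinite (volume : Measure β)]
    {f c : α → ℝ} {g : α → β → ℝ} (hf : Measurable f) (hg : Measurable fun p : α × β => g p.1 p.2)
    (hg0 : ∀ a b, 0 ≤ g a b) (hgi : ∀ a, Integrable (g a)) (hgc : ∀ a, ∫ b, g a b ≤ c a)
    (h : Integrable fun a => f a * c a) :
    Integrable (fun p : α × β => f p.1 * g p.1 p.2) := by
  have hm : Measurable fun p : α × β => f p.1 * g p.1 p.2 := (hf.comp measurable_fst).mul hg
  rw [Measure.volume_eq_prod, integrable_prod_iff hm.aestronglyMeasurable]
  refine ⟨ae_of_all _ fun a => (hgi a).const_mul (f a), ?_⟩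
  simp only [norm_mul, Real.norm_of_nonneg (hg0 _ _), integral_const_mul]
  have hm2 : StronglyMeasurable fun a => ∫ b, g a b :=
    StronglyMeasurable.integral_prod_right (f := g) hg.stronglyMeasurable
  refine h.mono (hf.stronglyMeasurable.norm.mul hm2).aestronglyMeasurable (ae_of_all _ fun a => ?_)
  have h0 : 0 ≤ ∫ b, g a b := integral_nonneg (hg0 a)
  rw [norm_mul, norm_mul, norm_norm, Real.norm_of_nonneg h0, Real.norm_of_nonneg (h0.trans (hgc a))]
  exact mul_le_mul_of_nonneg_left (hgc a) (norm_nonneg _)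

section Trajectories

variable {n m T : ℕ}

/-- Appending a last input and a last state to a trajectory. -/
def snocEquiv (n m T : ℕ) :
    ((Fin T → (Fin m → ℝ) × (Fin n → ℝ)) × (Fin m → ℝ)) × (Fin n → ℝ) ≃ᵐ
      (Fin (T + 1) → (Fin m → ℝ) × (Fin n → ℝ)) :=
  (MeasurableEquiv.prodAssoc.trans MeasurableEquiv.prodComm).trans
    (MeasurableEquiv.piFinSuccAbove (fun _ => (Fin m → ℝ) × (Fin n → ℝ)) (Fin.last T)).symm

lemma snocEquiv_apply (p : ((Fin T → (Fin m → ℝ) × (Fin n → ℝ)) × (Fin m → ℝ)) × (Fin n → ℝ)) :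
    snocEquiv n m T p = Fin.snoc p.1.1 (p.1.2, p.2) := by
  simp [snocEquiv, MeasurableEquiv.piFinSuccAbove_symm_apply, Fin.insertNthEquiv,
    MeasurableEquiv.prodAssoc, MeasurableEquiv.prodComm, Fin.insertNth_last']

lemma measurePreserving_snocEquiv : MeasurePreserving (snocEquiv n m T) := by
  have h1 : MeasurePreserving (MeasurableEquiv.prodAssoc :
      ((Fin T → (Fin m → ℝ) × (Fin n → ℝ)) × (Fin m → ℝ)) × (Fin n → ℝ) ≃ᵐ _) volume volume :=
    volume_preserving_prodAssoc
  have h2 : MeasurePreserving (MeasurableEquiv.prodComm :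
      (Fin T → (Fin m → ℝ) × (Fin n → ℝ)) × ((Fin m → ℝ) × (Fin n → ℝ)) ≃ᵐ _) volume volume :=
    Measure.measurePreserving_swap
  exact ((volume_preserving_piFinSuccAbove (fun _ => (Fin m → ℝ) × (Fin n → ℝ))
    (Fin.last T)).symm _).comp (h2.comp h1)

lemma integrable_snoc_iff {F : (Fin (T + 1) → (Fin m → ℝ) × (Fin n → ℝ)) → ℝ} :
    Integrable F ↔ Integrable fun p : ((Fin T → (Fin m → ℝ) × (Fin n → ℝ)) × (Fin m → ℝ)) ×
      (Fin n → ℝ) => F (Fin.snoc p.1.1 (p.1.2, p.2)) := by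
  rw [← measurePreserving_snocEquiv.integrable_comp_emb (snocEquiv n m T).measurableEmbedding]
  simp only [Function.comp_def, snocEquiv_apply]

lemma integral_snoc (F : (Fin (T + 1) → (Fin m → ℝ) × (Fin n → ℝ)) → ℝ) :
    ∫ d, F d = ∫ p : ((Fin T → (Fin m → ℝ) × (Fin n → ℝ)) × (Fin m → ℝ)) × (Fin n → ℝ),
      F (Fin.snoc p.1.1 (p.1.2, p.2)) := by
  rw [← measurePreserving_snocEquiv.integral_comp' (g := F)]
  simp only [snocEquiv_apply]

lemma truncate_castSucc (x₀ : Fin n → ℝ) (d : Fin T → (Fin m → ℝ) × (Fin n → ℝ))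
    (e : (Fin m → ℝ) × (Fin n → ℝ)) (k : Fin T) :
    truncate x₀ (Fin.snoc d e : Fin (T + 1) → _) k.castSucc = truncate x₀ d k := by
  refine Prod.ext rfl (funext fun i => ?_)
  have : Fin.castLE k.castSucc.isLt.le i = (Fin.castLE k.isLt.le i).castSucc := rfl
  simp only [truncate]
  rw [this, Fin.snoc_castSucc]

lemma truncate_last (x₀ : Fin n → ℝ) (d : Fin T → (Fin m → ℝ) × (Fin n → ℝ))
    (e : (Fin m → ℝ) × (Fin n → ℝ)) :
    truncate x₀ (Fin.snoc d e : Fin (T + 1) → _) (Fin.last T) = (x₀, d) := by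
  refine Prod.ext rfl (funext fun i => ?_)
  have : Fin.castLE (Fin.last T).isLt.le i = (i : Fin T).castSucc := rfl
  simp only [truncate]
  rw [this, Fin.snoc_castSucc]

lemma measurable_lastState (k : ℕ) :
    Measurable (History.lastState : History n m k → (Fin n → ℝ)) := by
  cases k with
  | zero => exact measurable_fst
  | succ k => exact measurable_snd.comp ((measurable_pi_apply _).comp measurable_snd)

lemma measurable_truncate (x₀ : Fin n → ℝ) (k : Fin T) :
    Measurable fun d : Fin T → (Fin m → ℝ) × (Fin n → ℝ) => truncate x₀ d k :=
  measurable_const.prodMk (measurable_pi_lambda _ fun _ => measurable_pi_apply _)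

lemma measurable_transition (x₀ : Fin n → ℝ) (k : Fin T)
    {Z : (Fin n → ℝ) → (Fin m → ℝ) → (Fin n → ℝ) → ℝ}
    (hZ : Measurable fun p : ((Fin n → ℝ) × (Fin m → ℝ)) × (Fin n → ℝ) => Z p.1.1 p.1.2 p.2) :
    Measurable fun d : Fin T → (Fin m → ℝ) × (Fin n → ℝ) =>
      Z (truncate x₀ d k).lastState (d k).1 (d k).2 := by
  have h1 : Measurable fun d : Fin T → (Fin m → ℝ) × (Fin n → ℝ) =>
      (((truncate x₀ d k).lastState, (d k).1), (d k).2) :=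
    (((measurable_lastState _).comp (measurable_truncate x₀ k)).prodMk
      (measurable_fst.comp (measurable_pi_apply k))).prodMk
        (measurable_snd.comp (measurable_pi_apply k))
  exact hZ.comp h1

/-- One plus the squared norm of a trajectory. -/
def trajWeight (d : Fin T → (Fin m → ℝ) × (Fin n → ℝ)) : ℝ :=
  1 + ∑ k, ((d k).1 ⬝ᵥ (d k).1 + (d k).2 ⬝ᵥ (d k).2)

lemma trajWeight_snoc (d : Fin T → (Fin m → ℝ) × (Fin n → ℝ)) (u : Fin m → ℝ) (x : Fin n → ℝ) :
    trajWeight (Fin.snoc d (u, x) : Fin (T + 1) → _) = trajWeight d + u ⬝ᵥ u + x ⬝ᵥ x := by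
  simp only [trajWeight, Fin.sum_univ_castSucc, Fin.snoc_castSucc, Fin.snoc_last]
  ring

lemma le_trajWeight (d : Fin T → (Fin m → ℝ) × (Fin n → ℝ)) (k : Fin T) :
    1 + ((d k).1 ⬝ᵥ (d k).1 + (d k).2 ⬝ᵥ (d k).2) ≤ trajWeight d := by
  have := Finset.single_le_sum (s := Finset.univ)
    (f := fun k => (d k).1 ⬝ᵥ (d k).1 + (d k).2 ⬝ᵥ (d k).2)
    (fun i _ => add_nonneg (dotProduct_self_nonneg_real _) (dotProduct_self_nonneg_real _))
    (Finset.mem_univ k)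
  rw [trajWeight]
  linarith

lemma one_le_trajWeight (d : Fin T → (Fin m → ℝ) × (Fin n → ℝ)) : 1 ≤ trajWeight d := by
  have := Finset.sum_nonneg (s := Finset.univ)
    (f := fun k => (d k).1 ⬝ᵥ (d k).1 + (d k).2 ⬝ᵥ (d k).2)
    (fun i _ => add_nonneg (dotProduct_self_nonneg_real _) (dotProduct_self_nonneg_real _))
  rw [trajWeight]
  linarith

lemma continuous_trajWeight :
    Continuous (trajWeight : (Fin T → (Fin m → ℝ) × (Fin n → ℝ)) → ℝ) := by
  unfold trajWeight
  fun_prop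

/-- The last state is either `x₀`, controlled by the constant since the weight is at least one, or a
stored state, whose square is a summand of the weight. -/
lemma lastState_dotProduct_le (x₀ : Fin n → ℝ) :
    ∀ {k : ℕ} (d : Fin k → (Fin m → ℝ) × (Fin n → ℝ)),
      (History.lastState ((x₀, d) : History n m k)) ⬝ᵥ
        (History.lastState ((x₀, d) : History n m k)) ≤ (x₀ ⬝ᵥ x₀ + 1) * trajWeight d
  | 0, d => by
    have h1 := one_le_trajWeight d
    have h2 := dotProduct_self_nonneg_real x₀
    change x₀ ⬝ᵥ x₀ ≤ _
    nlinarith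
  | k + 1, d => by
    have h1 := le_trajWeight d (Fin.last k)
    have h2 := dotProduct_self_nonneg_real x₀
    have h3 := dotProduct_self_nonneg_real (d (Fin.last k)).1
    have h4 := one_le_trajWeight d
    change (d (Fin.last k)).2 ⬝ᵥ (d (Fin.last k)).2 ≤ _
    nlinarith

lemma truncate_lastState_dotProduct_le (x₀ : Fin n → ℝ)
    (d : Fin T → (Fin m → ℝ) × (Fin n → ℝ)) (k : Fin T) :
    (truncate x₀ d k).lastState ⬝ᵥ (truncate x₀ d k).lastState ≤
      (x₀ ⬝ᵥ x₀ + 1) * trajWeight d := by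
  induction T with
  | zero => exact k.elim0
  | succ T ih =>
    obtain ⟨d, e, rfl⟩ : ∃ (d' : Fin T → (Fin m → ℝ) × (Fin n → ℝ)) (e : _),
      d = Fin.snoc d' e := ⟨Fin.init d, d (Fin.last T), (Fin.snoc_init_self d).symm⟩
    have h1 := trajWeight_snoc d e.1 e.2
    have h2 := dotProduct_self_nonneg_real e.1
    have h3 := dotProduct_self_nonneg_real e.2
    have h4 : (x₀ ⬝ᵥ x₀ + 1) * trajWeight d ≤
        (x₀ ⬝ᵥ x₀ + 1) * trajWeight (Fin.snoc d e : Fin (T + 1) → _) := by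
      refine mul_le_mul_of_nonneg_left ?_ (by linarith [dotProduct_self_nonneg_real x₀])
      linarith
    refine le_trans ?_ h4
    refine Fin.lastCases ?_ (fun k => ?_) k
    · rw [truncate_last]
      exact lastState_dotProduct_le x₀ d
    · rw [truncate_castSucc]
      exact ih d k

end Trajectories

lemma IsAdmissible.mono {n m T T' : ℕ} {π : Policy n m} (h : IsAdmissible T π) (hT : T' ≤ T) :
    IsAdmissible T' π :=
  fun k hk => h k (hk.trans_le hT)

/-! ### Joint densities in closed loop: normalisation, martingale differences, second moments -/

namespace GaussianProblem

variable {n m : ℕ} {D : GaussianProblem n m}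

lemma continuous_modelPdf (t : ℕ) :
    Continuous fun p : ((Fin n → ℝ) × (Fin m → ℝ)) × (Fin n → ℝ) =>
      D.modelPdf t p.1.1 p.1.2 p.2 := by
  have h : Continuous fun p : ((Fin n → ℝ) × (Fin m → ℝ)) × (Fin n → ℝ) =>
      (D.A t *ᵥ p.1.1 + D.B t *ᵥ p.1.2, p.2) := by fun_prop
  exact (continuous_gaussianPdf (D.noiseCov t)).comp h

lemma modelPdf_pos (hS : ∀ t, 1 ≤ t → (D.noiseCov t).PosDef) {t : ℕ} (ht : 1 ≤ t)
    (x : Fin n → ℝ) (u : Fin m → ℝ) (x' : Fin n → ℝ) : 0 < D.modelPdf t x u x' :=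
  gaussianPdf_pos (hS t ht) _ _

lemma integrable_modelPdf (hS : ∀ t, 1 ≤ t → (D.noiseCov t).PosDef) {t : ℕ} (ht : 1 ≤ t)
    (x : Fin n → ℝ) (u : Fin m → ℝ) : Integrable (D.modelPdf t x u) :=
  integrable_gaussianPdf (hS t ht) _

lemma integral_modelPdf (hS : ∀ t, 1 ≤ t → (D.noiseCov t).PosDef) {t : ℕ} (ht : 1 ≤ t)
    (x : Fin n → ℝ) (u : Fin m → ℝ) : ∫ x', D.modelPdf t x u x' = 1 :=
  integral_gaussianPdf (hS t ht) _

lemma exists_integral_modelPdf_mul_le (hS : ∀ t, 1 ≤ t → (D.noiseCov t).PosDef) {t : ℕ}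
    (ht : 1 ≤ t) : ∃ K : ℝ, 0 ≤ K ∧ ∀ x u,
      Integrable (fun x' => D.modelPdf t x u x' * (1 + x' ⬝ᵥ x')) ∧
      ∫ x', D.modelPdf t x u x' * (1 + x' ⬝ᵥ x') ≤ K * (1 + x ⬝ᵥ x + u ⬝ᵥ u) := by
  obtain ⟨K₂, hK₂, h₂⟩ := exists_integral_gaussianPdf_mul_le (hS t ht)
  obtain ⟨K₃, hK₃, h₃⟩ := exists_mulVec_dotProduct_self_le (D.A t)
  obtain ⟨K₄, hK₄, h₄⟩ := exists_mulVec_dotProduct_self_le (D.B t)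
  refine ⟨K₂ * (1 + 2 * K₃ + 2 * K₄), by positivity, fun x u => ⟨(h₂ _).1, (h₂ _).2.trans ?_⟩⟩
  rw [mul_assoc]
  refine mul_le_mul_of_nonneg_left ?_ hK₂
  have e1 := add_dotProduct_self_le (D.A t *ᵥ x) (D.B t *ᵥ u)
  have e2 := h₃ x
  have e3 := h₄ u
  have e4 := dotProduct_self_nonneg_real x
  have e5 := dotProduct_self_nonneg_real u
  have e6 : 0 ≤ K₃ * (u ⬝ᵥ u) := by positivity
  have e7 : 0 ≤ K₄ * (x ⬝ᵥ x) := by positivity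
  nlinarith

lemma jointPdf_snoc (T : ℕ) (π : Policy n m) (x₀ : Fin n → ℝ)
    (d : Fin T → (Fin m → ℝ) × (Fin n → ℝ)) (u : Fin m → ℝ) (x : Fin n → ℝ) :
    D.jointPdf (T + 1) π x₀ (Fin.snoc d (u, x) : Fin (T + 1) → _) =
      D.jointPdf T π x₀ d * π T (x₀, d) u *
        D.modelPdf (T + 1) (History.lastState ((x₀, d) : History n m T)) u x := by
  rw [jointPdf, Fin.prod_univ_castSucc, jointPdf]
  simp only [Fin.snoc_castSucc, Fin.snoc_last, truncate_castSucc, truncate_last]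
  rw [mul_assoc]
  congr 1
  exact mul_comm _ _

variable {T : ℕ} {π : Policy n m}

lemma jointPdf_nonneg (hS : ∀ t, 1 ≤ t → (D.noiseCov t).PosDef) (hπ : IsAdmissible T π)
    (x₀ : Fin n → ℝ) (d : Fin T → (Fin m → ℝ) × (Fin n → ℝ)) : 0 ≤ D.jointPdf T π x₀ d :=
  Finset.prod_nonneg fun k _ => mul_nonneg
    (modelPdf_pos hS (Nat.le_add_left 1 _) _ _ _).le ((hπ k k.isLt).2.1 _ _)

lemma measurable_policy (hπ : IsAdmissible T π) {k : ℕ} (hk : k < T) (x₀ : Fin n → ℝ) :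
    Measurable fun p : (Fin k → (Fin m → ℝ) × (Fin n → ℝ)) × (Fin m → ℝ) =>
      π k (x₀, p.1) p.2 :=
  have h1 : Measurable fun p : (Fin k → (Fin m → ℝ) × (Fin n → ℝ)) × (Fin m → ℝ) =>
      (((x₀, p.1) : History n m k), p.2) :=
    (measurable_const.prodMk measurable_fst).prodMk measurable_snd
  (hπ k hk).1.comp h1

lemma measurable_jointPdf (hπ : IsAdmissible T π) (x₀ : Fin n → ℝ) :
    Measurable (D.jointPdf T π x₀) := by
  refine Finset.measurable_fun_prod _ fun k _ => Measurable.mul ?_ ?_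
  · exact measurable_transition x₀ k (continuous_modelPdf (k + 1)).measurable
  · have h1 : Measurable fun d : Fin T → (Fin m → ℝ) × (Fin n → ℝ) =>
        (truncate x₀ d k, (d k).1) :=
      (measurable_truncate x₀ k).prodMk (measurable_fst.comp (measurable_pi_apply k))
    exact (hπ k k.isLt).1.comp h1

/-- The model density as a kernel. -/
lemma measurable_modelPdf_comp {α : Type*} [MeasurableSpace α] (D : GaussianProblem n m) (t : ℕ)
    {y : α → (Fin n → ℝ)} (hy : Measurable y) :
    Measurable fun p : (α × (Fin m → ℝ)) × (Fin n → ℝ) => D.modelPdf t (y p.1.1) p.1.2 p.2 := by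
  have h2 : Measurable fun p : (α × (Fin m → ℝ)) × (Fin n → ℝ) => ((y p.1.1, p.1.2), p.2) :=
    ((hy.comp (measurable_fst.comp measurable_fst)).prodMk
      (measurable_snd.comp measurable_fst)).prodMk measurable_snd
  have h3 := (continuous_modelPdf (D := D) t).measurable.comp h2
  exact h3

lemma _root_.FPC.measurable_lastState_mk (x₀ : Fin n → ℝ) :
    Measurable fun d : Fin T → (Fin m → ℝ) × (Fin n → ℝ) =>
      History.lastState ((x₀, d) : History n m T) :=
  (measurable_lastState T).comp measurable_prodMk_left

lemma _root_.FPC.IsAdmissible.integrable {k : ℕ} (hπ : IsAdmissible T π) (hk : k < T) (h : History n m k) :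
    Integrable (π k h) :=
  Integrable.of_integral_ne_zero (by rw [(hπ k hk).2.2 h]; exact one_ne_zero)

/-- Weights depending on the past are integrated out with respect to the new input. -/
lemma integrable_mul_policy (hπ : IsAdmissible T π) {k : ℕ} (hk : k < T) (x₀ : Fin n → ℝ)
    {f : (Fin k → (Fin m → ℝ) × (Fin n → ℝ)) → ℝ} (hf : Measurable f) (hfi : Integrable f) :
    Integrable fun p : (Fin k → (Fin m → ℝ) × (Fin n → ℝ)) × (Fin m → ℝ) =>
      f p.1 * π k (x₀, p.1) p.2 :=
  integrable_mul_kernel (c := fun _ => 1) (g := fun d u => π k (x₀, d) u) hf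
    (measurable_policy hπ hk x₀)
    (fun _ _ => (hπ k hk).2.1 _ _) (fun _ => hπ.integrable hk _)
    (fun _ => ((hπ k hk).2.2 _).le) (by simpa using hfi)

/-- Weights depending on the past are integrated out with respect to the new state. -/
lemma integrable_mul_modelPdf {α : Type*} [MeasureSpace α]
    (hS : ∀ t, 1 ≤ t → (D.noiseCov t).PosDef) {t : ℕ} (ht : 1 ≤ t)
    {y : α → (Fin n → ℝ)} (hy : Measurable y) {f : α × (Fin m → ℝ) → ℝ}
    (hf : Measurable f) (hfi : Integrable f) :
    Integrable fun p : (α × (Fin m → ℝ)) × (Fin n → ℝ) =>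
      f p.1 * D.modelPdf t (y p.1.1) p.1.2 p.2 := by
  have h := integrable_mul_kernel (f := f) (c := fun _ => 1)
    (g := fun q x => D.modelPdf t (y q.1) q.2 x) hf (measurable_modelPdf_comp D t hy)
    (fun q x => (modelPdf_pos hS ht (y q.1) q.2 x).le)
    (fun q => integrable_modelPdf hS ht (y q.1) q.2)
    (fun q => (integral_modelPdf hS ht (y q.1) q.2).le) (by simpa using hfi)
  exact h

/-- Second moments of the new state are finite if those of the past are. -/
lemma integrable_mul_modelPdf_mul {α : Type*} [MeasureSpace α]
    (hS : ∀ t, 1 ≤ t → (D.noiseCov t).PosDef) {t : ℕ} (ht : 1 ≤ t)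
    {y : α → (Fin n → ℝ)} (hy : Measurable y) {f : α × (Fin m → ℝ) → ℝ}
    (hf : Measurable f) {w : α → ℝ} {K : ℝ} (hK : 0 ≤ K) (hw : ∀ a, 1 ≤ w a)
    (hyw : ∀ a, y a ⬝ᵥ y a ≤ K * w a)
    (hfi : Integrable fun p => f p * (w p.1 + (1 + p.2 ⬝ᵥ p.2))) :
    Integrable fun p : (α × (Fin m → ℝ)) × (Fin n → ℝ) =>
      f p.1 * (D.modelPdf t (y p.1.1) p.1.2 p.2 * (1 + p.2 ⬝ᵥ p.2)) := by
  obtain ⟨K₂, hK₂, h₂⟩ := exists_integral_modelPdf_mul_le hS ht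
  have hm := measurable_modelPdf_comp D t hy
  have hpos := fun x u x' => modelPdf_pos hS ht x u x'
  generalize D.modelPdf t = p at *
  have mx : Measurable fun x : Fin n → ℝ => 1 + x ⬝ᵥ x := Continuous.measurable (by fun_prop)
  have h1 : ∀ q : α × (Fin m → ℝ), ∫ x, p (y q.1) q.2 x * (1 + x ⬝ᵥ x) ≤
      K₂ * (K + 1) * (w q.1 + (1 + q.2 ⬝ᵥ q.2)) := fun q => by
    refine (h₂ (y q.1) q.2).2.trans ?_
    rw [mul_assoc]
    refine mul_le_mul_of_nonneg_left ?_ hK₂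
    have e4 := hyw q.1
    have e5 := hw q.1
    have e6 := dotProduct_self_nonneg_real q.2
    have e7 : 0 ≤ K * (q.2 ⬝ᵥ q.2) := by positivity
    nlinarith
  have h2 : Integrable fun q : α × (Fin m → ℝ) =>
      f q * (K₂ * (K + 1) * (w q.1 + (1 + q.2 ⬝ᵥ q.2))) := by
    refine (hfi.const_mul (K₂ * (K + 1))).congr (ae_of_all _ fun q => ?_)
    simp only
    ring
  have h3 : ∀ (q : α × (Fin m → ℝ)) (x : Fin n → ℝ),
      0 ≤ p (y q.1) q.2 x * (1 + x ⬝ᵥ x) := fun q x => by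
    have e1 := hpos (y q.1) q.2 x
    have e2 := dotProduct_self_nonneg_real x
    positivity
  have h4 := hm.mul (mx.comp measurable_snd)
  simp only [Pi.mul_def, Function.comp_def] at h4
  have h5 := integrable_mul_kernel (g := fun q x => p (y q.1) q.2 x * (1 + x ⬝ᵥ x)) hf
    h4 h3 (fun q => (h₂ (y q.1) q.2).1) h1 h2
  exact h5

/-- Fubini, with the new state integrated first and the new input second: both conditional densities
have mass one, so a function of the past keeps its integral. -/
lemma integral_mul_policy_mul_modelPdf (hS : ∀ t, 1 ≤ t → (D.noiseCov t).PosDef)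
    (hπ : IsAdmissible (T + 1) π)
    (x₀ : Fin n → ℝ) {f : (Fin T → (Fin m → ℝ) × (Fin n → ℝ)) → ℝ} (hf : Measurable f)
    (hfi : Integrable f) :
    ∫ p : ((Fin T → (Fin m → ℝ) × (Fin n → ℝ)) × (Fin m → ℝ)) × (Fin n → ℝ),
      f p.1.1 * π T (x₀, p.1.1) p.1.2 *
        D.modelPdf (T + 1) (History.lastState ((x₀, p.1.1) : History n m T)) p.1.2 p.2 =
      ∫ d, f d := by
  have i1 := integrable_mul_policy hπ (Nat.lt_succ_self T) x₀ hf hfi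
  have m1 : Measurable fun p : (Fin T → (Fin m → ℝ) × (Fin n → ℝ)) × (Fin m → ℝ) =>
      f p.1 * π T (x₀, p.1) p.2 :=
    (hf.comp measurable_fst).mul (measurable_policy hπ (Nat.lt_succ_self T) x₀)
  have i2 := integrable_mul_modelPdf (D := D) hS (Nat.le_add_left 1 T)
    (measurable_lastState_mk x₀) m1 i1
  rw [Measure.volume_eq_prod] at i2 i1
  rw [Measure.volume_eq_prod, integral_prod _ i2]
  simp only [integral_const_mul, integral_modelPdf hS (Nat.le_add_left 1 T), mul_one]
  rw [Measure.volume_eq_prod, integral_prod _ i1]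
  simp only [integral_const_mul, (hπ T (Nat.lt_succ_self T)).2.2, mul_one]

lemma integrable_jointPdf_and_integral (hS : ∀ t, 1 ≤ t → (D.noiseCov t).PosDef)
    (hπ : IsAdmissible T π) (x₀ : Fin n → ℝ) :
    Integrable (D.jointPdf T π x₀) ∧ ∫ d, D.jointPdf T π x₀ d = 1 := by
  induction T with
  | zero =>
    have h : ∫ d, D.jointPdf 0 π x₀ d = 1 := by
      simp [jointPdf, volume_pi, measureReal_def]
    exact ⟨Integrable.of_integral_ne_zero (by rw [h]; exact one_ne_zero), h⟩
  | succ T ih =>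
    obtain ⟨i1, e1⟩ := ih (hπ.mono T.le_succ)
    have m1 := measurable_jointPdf (D := D) (hπ.mono T.le_succ) x₀
    have h : ∫ d, D.jointPdf (T + 1) π x₀ d = 1 := by
      rw [integral_snoc]
      simp only [jointPdf_snoc]
      rw [integral_mul_policy_mul_modelPdf hS hπ x₀ m1 i1, e1]
    exact ⟨Integrable.of_integral_ne_zero (by rw [h]; exact one_ne_zero), h⟩

/-- Functions of a transition that are centred given the past and the input have expectation
zero in closed loop. -/
lemma integral_jointPdf_mul_eq_zero (hS : ∀ t, 1 ≤ t → (D.noiseCov t).PosDef)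
    (hπ : IsAdmissible T π) (x₀ : Fin n → ℝ) (k : Fin T)
    {Z : (Fin n → ℝ) → (Fin m → ℝ) → (Fin n → ℝ) → ℝ}
    (hZm : Measurable fun p : ((Fin n → ℝ) × (Fin m → ℝ)) × (Fin n → ℝ) => Z p.1.1 p.1.2 p.2)
    (hZ : ∀ x u, ∫ x', D.modelPdf (k + 1) x u x' * Z x u x' = 0)
    (hi : Integrable fun d => D.jointPdf T π x₀ d *
      Z (truncate x₀ d k).lastState (d k).1 (d k).2) :
    ∫ d, D.jointPdf T π x₀ d * Z (truncate x₀ d k).lastState (d k).1 (d k).2 = 0 := by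
  induction T with
  | zero => exact k.elim0
  | succ T ih =>
    rw [integrable_snoc_iff] at hi
    rw [integral_snoc]
    revert hi hZ
    refine Fin.lastCases ?_ (fun k => ?_) k
    -- For the last transition, the innermost integral over the last state vanishes by `hZ`.
    · intro hZ hi
      simp only [jointPdf_snoc, truncate_last, Fin.snoc_last, mul_assoc] at hi ⊢
      rw [Measure.volume_eq_prod] at hi ⊢
      rw [integral_prod _ hi]
      simp only [integral_const_mul]
      have hZ' : ∀ x u, ∫ x', D.modelPdf (T + 1) x u x' * Z x u x' = 0 := hZ
      simp only [hZ', mul_zero, integral_zero]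
    · intro hZ hi
      simp only [jointPdf_snoc, truncate_castSucc, Fin.snoc_castSucc] at hi ⊢
      have m1 := measurable_jointPdf (D := D) (hπ.mono T.le_succ) x₀
      have m2 : Measurable fun d : Fin T → (Fin m → ℝ) × (Fin n → ℝ) =>
          Z (truncate x₀ d k).lastState (d k).1 (d k).2 :=
        measurable_transition x₀ k hZm
      -- For an earlier transition, `Z` depends only on the truncated trajectory. Moving it next to
      -- the past density lets the last input and state be integrated out.
      have hre : ∀ a b c e : ℝ, a * b * c * e = a * e * b * c := fun a b c e => by ring
      simp only [hre _ _ _ (Z _ _ _)] at hi ⊢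
      -- Integrability over the shorter horizon is obtained by marginalising the given integrable
      -- function twice.
      have i1 : Integrable fun d => D.jointPdf T π x₀ d *
          Z (truncate x₀ d k).lastState (d k).1 (d k).2 := by
        rw [Measure.volume_eq_prod] at hi
        have i2 := hi.integral_prod_left
        simp only [integral_const_mul, integral_modelPdf hS (Nat.le_add_left 1 T), mul_one] at i2
        rw [Measure.volume_eq_prod] at i2
        have i3 := i2.integral_prod_left
        simpa only [integral_const_mul, (hπ T (Nat.lt_succ_self T)).2.2, mul_one] using i3
      rw [integral_mul_policy_mul_modelPdf hS hπ x₀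
        (f := fun d => D.jointPdf T π x₀ d * Z (truncate x₀ d k).lastState (d k).1 (d k).2)
        (m1.mul m2) i1]
      exact ih (hπ.mono T.le_succ) k hZ i1

/-- Gaussian strategies with a linearly bounded mean lead to finite second moments. -/
lemma integrable_jointPdf_mul_trajWeight (hS : ∀ t, 1 ≤ t → (D.noiseCov t).PosDef)
    (hπ : IsAdmissible T π)
    (hG : ∀ k < T, ∃ (G : (Fin n → ℝ) → (Fin m → ℝ)) (V : Matrix (Fin m) (Fin m) ℝ) (K : ℝ),
      V.PosDef ∧ 0 ≤ K ∧ (∀ x, G x ⬝ᵥ G x ≤ K * (x ⬝ᵥ x)) ∧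
      ∀ (h : History n m k) u, π k h u = gaussianPdf (G h.lastState) V u)
    (x₀ : Fin n → ℝ) : Integrable fun d => D.jointPdf T π x₀ d * trajWeight d := by
  induction T with
  | zero =>
    have := (integrable_jointPdf_and_integral (D := D) hS hπ x₀).1
    simpa [trajWeight] using this
  | succ T ih =>
    have hπ' := hπ.mono T.le_succ
    have i0 := ih hπ' fun k hk => hG k (hk.trans T.lt_succ_self)
    have m0 := measurable_jointPdf (D := D) hπ' x₀
    obtain ⟨G, V, K, hV, hK, hGK, hGe⟩ := hG T T.lt_succ_self
    obtain ⟨K₁, hK₁, h₁⟩ := exists_integral_gaussianPdf_mul_le hV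
    have mπ := measurable_policy hπ T.lt_succ_self x₀
    have mW : Measurable (trajWeight : (Fin T → (Fin m → ℝ) × (Fin n → ℝ)) → ℝ) :=
      continuous_trajWeight.measurable
    have hls := fun d : Fin T → (Fin m → ℝ) × (Fin n → ℝ) => lastState_dotProduct_le x₀ d
    have hx0 := dotProduct_self_nonneg_real x₀
    have mu : Measurable fun u : Fin m → ℝ => 1 + u ⬝ᵥ u := Continuous.measurable (by fun_prop)
    have j1 := integrable_mul_policy hπ T.lt_succ_self x₀
      (f := fun d => D.jointPdf T π x₀ d * trajWeight d) (m0.mul mW) i0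
    have j2 : Integrable fun p : (Fin T → (Fin m → ℝ) × (Fin n → ℝ)) × (Fin m → ℝ) =>
        D.jointPdf T π x₀ p.1 * (π T (x₀, p.1) p.2 * (1 + p.2 ⬝ᵥ p.2)) := by
      refine integrable_mul_kernel (g := fun d u => π T (x₀, d) u * (1 + u ⬝ᵥ u))
        -- The conditional second moment of the input is at most `K₁(1 + |G x|²)`, with `|G x|² ≤
        -- K|x|²` and `|x|² ≤ (|x₀|² + 1)` times the weight of the past.
        (c := fun d => K₁ * (1 + K * (x₀ ⬝ᵥ x₀ + 1)) * trajWeight d) m0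
        (mπ.mul (mu.comp measurable_snd))
        (fun d u => mul_nonneg ((hπ T T.lt_succ_self).2.1 _ _)
          (by linarith [dotProduct_self_nonneg_real u])) (fun d => ?_) (fun d => ?_) ?_
      · simp only [hGe]
        exact (h₁ _).1
      · simp only [hGe]
        refine (h₁ _).2.trans ?_
        rw [mul_assoc]
        refine mul_le_mul_of_nonneg_left ?_ hK₁
        have e1 := hGK (History.lastState ((x₀, d) : History n m T))
        have e2 := mul_le_mul_of_nonneg_left (hls d) hK
        have e3 := one_le_trajWeight d
        nlinarith
      · refine (i0.const_mul (K₁ * (1 + K * (x₀ ⬝ᵥ x₀ + 1)))).congr (ae_of_all _ fun d => ?_)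
        simp only
        ring
    have j3 : Integrable fun p : (Fin T → (Fin m → ℝ) × (Fin n → ℝ)) × (Fin m → ℝ) =>
        D.jointPdf T π x₀ p.1 * π T (x₀, p.1) p.2 * (trajWeight p.1 + (1 + p.2 ⬝ᵥ p.2)) := by
      refine (j1.add j2).congr (ae_of_all _ fun p => ?_)
      simp only [Pi.add_apply]
      ring
    have m3 : Measurable fun p : (Fin T → (Fin m → ℝ) × (Fin n → ℝ)) × (Fin m → ℝ) =>
        D.jointPdf T π x₀ p.1 * π T (x₀, p.1) p.2 := (m0.comp measurable_fst).mul mπ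
    have m4 : Measurable fun p : (Fin T → (Fin m → ℝ) × (Fin n → ℝ)) × (Fin m → ℝ) =>
        trajWeight p.1 + (1 + p.2 ⬝ᵥ p.2) :=
      (mW.comp measurable_fst).add (mu.comp measurable_snd)
    have j4 := integrable_mul_modelPdf (D := D) hS (Nat.le_add_left 1 T)
      (measurable_lastState_mk x₀)
      (f := fun p => D.jointPdf T π x₀ p.1 * π T (x₀, p.1) p.2 *
        (trajWeight p.1 + (1 + p.2 ⬝ᵥ p.2))) (m3.mul m4) j3
    have j5 : Integrable fun p : ((Fin T → (Fin m → ℝ) × (Fin n → ℝ)) × (Fin m → ℝ)) ×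
        (Fin n → ℝ) => D.jointPdf T π x₀ p.1.1 * π T (x₀, p.1.1) p.1.2 *
          (D.modelPdf (T + 1) (History.lastState ((x₀, p.1.1) : History n m T)) p.1.2 p.2 *
            (1 + p.2 ⬝ᵥ p.2)) :=
      integrable_mul_modelPdf_mul hS (Nat.le_add_left 1 T) (measurable_lastState_mk x₀) m3
        (by positivity) one_le_trajWeight hls j3
    rw [integrable_snoc_iff]
    refine (j4.add j5).mono ?_ (ae_of_all _ fun p => ?_)
    · have h1 := ((measurable_jointPdf (D := D) hπ x₀).mul
        continuous_trajWeight.measurable).comp (snocEquiv n m T).measurable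
      simp only [Function.comp_def, Pi.mul_apply, snocEquiv_apply] at h1
      exact h1.aestronglyMeasurable
    · have e1 := jointPdf_nonneg (D := D) hS hπ x₀ (Fin.snoc p.1.1 (p.1.2, p.2))
      have e2 := one_le_trajWeight p.1.1
      have e3 := dotProduct_self_nonneg_real p.1.2
      have e4 := dotProduct_self_nonneg_real p.2
      rw [trajWeight_snoc, Real.norm_of_nonneg (mul_nonneg e1 (by linarith))]
      have e5 : trajWeight p.1.1 + p.1.2 ⬝ᵥ p.1.2 + p.2 ⬝ᵥ p.2 ≤
          (trajWeight p.1.1 + (1 + p.1.2 ⬝ᵥ p.1.2)) + (1 + p.2 ⬝ᵥ p.2) := by linarith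
      refine le_trans (le_trans (mul_le_mul_of_nonneg_left e5 e1) (le_of_eq ?_)) (le_abs_self _)
      rw [jointPdf_snoc]
      simp only [Pi.add_apply]
      ring

end GaussianProblem

/-! ### The ideal joint density and its exponential moments -/

lemma integrable_exp_mul_gaussianPdf_of_le {k : ℕ} {S : Matrix (Fin k) (Fin k) ℝ} (hS : S.PosDef)
    {ε ε' : ℝ} (hε : ε' ≤ ε)
    (h : Integrable fun x => Real.exp (ε * (x ⬝ᵥ x)) * gaussianPdf 0 S x) :
    Integrable fun x => Real.exp (ε' * (x ⬝ᵥ x)) * gaussianPdf 0 S x := by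
  refine h.mono' ?_ (ae_of_all _ fun x => ?_)
  · refine Continuous.aestronglyMeasurable (Continuous.mul (by fun_prop) ?_)
    exact (continuous_gaussianPdf S).comp (Continuous.prodMk continuous_const continuous_id)
  · have h1 := gaussianPdf_pos hS 0 x
    rw [Real.norm_of_nonneg (by positivity)]
    refine mul_le_mul_of_nonneg_right (Real.exp_le_exp.mpr ?_) h1.le
    exact mul_le_mul_of_nonneg_right hε (dotProduct_self_nonneg_real x)

lemma measurable_gaussianPdf {k : ℕ} (μ : Fin k → ℝ) (S : Matrix (Fin k) (Fin k) ℝ) :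
    Measurable (gaussianPdf μ S) :=
  ((continuous_gaussianPdf S).comp (Continuous.prodMk continuous_const continuous_id)).measurable

namespace GaussianProblem.IsStationary

variable {n m : ℕ} {D : GaussianProblem n m} {A : Matrix (Fin n) (Fin n) ℝ}
  {B : Matrix (Fin n) (Fin m) ℝ} {Ix : Matrix (Fin n) (Fin n) ℝ} {Iu : Matrix (Fin m) (Fin m) ℝ}

lemma idealStatePdf_eq (hD : D.IsStationary A B Ix Iu) {t : ℕ} (ht : 1 ≤ t) :
    D.idealStatePdf t = gaussianPdf 0 Ix := by
  funext x
  rw [idealStatePdf, hD.idealMeanX_eq t ht, hD.idealCovX_eq t ht]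

lemma idealControlPdf_eq (hD : D.IsStationary A B Ix Iu) {t : ℕ} (ht : 1 ≤ t) :
    D.idealControlPdf t = gaussianPdf 0 Iu := by
  funext x
  rw [idealControlPdf, hD.idealMeanU_eq t ht, hD.idealCovU_eq t ht]

lemma idealJointPdf_eq (hD : D.IsStationary A B Ix Iu) (T : ℕ)
    (d : Fin T → (Fin m → ℝ) × (Fin n → ℝ)) :
    D.idealJointPdf T d = ∏ k, (gaussianPdf 0 Iu (d k).1 * gaussianPdf 0 Ix (d k).2) := by
  refine Finset.prod_congr rfl fun k _ => ?_
  rw [hD.idealStatePdf_eq (Nat.le_add_left 1 _), hD.idealControlPdf_eq (Nat.le_add_left 1 _),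
    mul_comm]

lemma idealJointPdf_pos (hD : D.IsStationary A B Ix Iu) (T : ℕ)
    (d : Fin T → (Fin m → ℝ) × (Fin n → ℝ)) : 0 < D.idealJointPdf T d := by
  rw [hD.idealJointPdf_eq]
  exact Finset.prod_pos fun k _ =>
    mul_pos (gaussianPdf_pos hD.posDef_u _ _) (gaussianPdf_pos hD.posDef_x _ _)

lemma measurable_idealJointPdf (hD : D.IsStationary A B Ix Iu) (T : ℕ) :
    Measurable (D.idealJointPdf T) := by
  have h := funext (hD.idealJointPdf_eq T)
  rw [h]
  exact Finset.measurable_fun_prod _ fun k _ =>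
    ((measurable_gaussianPdf 0 Iu).comp (measurable_fst.comp (measurable_pi_apply k))).mul
      ((measurable_gaussianPdf 0 Ix).comp (measurable_snd.comp (measurable_pi_apply k)))

lemma integral_idealJointPdf (hD : D.IsStationary A B Ix Iu) (T : ℕ) :
    ∫ d, D.idealJointPdf T d = 1 := by
  simp only [hD.idealJointPdf_eq]
  rw [integral_fintype_prod_volume_eq_pow (fun e : (Fin m → ℝ) × (Fin n → ℝ) =>
    gaussianPdf 0 Iu e.1 * gaussianPdf 0 Ix e.2), Measure.volume_eq_prod, integral_prod_mul,
    integral_gaussianPdf hD.posDef_u, integral_gaussianPdf hD.posDef_x]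
  simp

/-- The ideal joint density has some square exponential moment. -/
lemma exists_integrable_idealJointPdf_mul_exp (hD : D.IsStationary A B Ix Iu) (T : ℕ) :
    ∃ ε : ℝ, 0 < ε ∧
      Integrable fun d => D.idealJointPdf T d * Real.exp (ε * trajWeight d) := by
  obtain ⟨ε₁, hε₁, h₁⟩ := exists_integrable_exp_mul_gaussianPdf hD.posDef_u
  obtain ⟨ε₂, hε₂, h₂⟩ := exists_integrable_exp_mul_gaussianPdf hD.posDef_x
  set ε := min ε₁ ε₂ with hε
  have h₁' := integrable_exp_mul_gaussianPdf_of_le hD.posDef_u (min_le_left ε₁ ε₂) h₁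
  have h₂' := integrable_exp_mul_gaussianPdf_of_le hD.posDef_x (min_le_right ε₁ ε₂) h₂
  rw [← hε] at h₁' h₂'
  refine ⟨ε, lt_min hε₁ hε₂, ?_⟩
  have h₃ : Integrable fun e : (Fin m → ℝ) × (Fin n → ℝ) =>
      (Real.exp (ε * (e.1 ⬝ᵥ e.1)) * gaussianPdf 0 Iu e.1) *
        (Real.exp (ε * (e.2 ⬝ᵥ e.2)) * gaussianPdf 0 Ix e.2) := h₁'.mul_prod h₂'
  have h₄ := (Integrable.fintype_prod (ι := Fin T) fun _ => h₃).const_mul (Real.exp ε)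
  refine h₄.congr (ae_of_all _ fun d => ?_)
  simp only
  rw [hD.idealJointPdf_eq, trajWeight, mul_add, mul_one, Real.exp_add, Finset.mul_sum,
    Real.exp_sum, mul_left_comm, ← Finset.prod_mul_distrib]
  congr 1
  refine Finset.prod_congr rfl fun k _ => ?_
  rw [mul_add, Real.exp_add]
  ring

lemma continuous_gammaToGo (hD : D.IsStationary A B Ix Iu) (s t : ℕ) :
    Continuous (D.gammaToGo s t) := by
  obtain ⟨C, -, h⟩ := hD.exists_gammaToGo_eq s t
  rw [funext h]
  fun_prop

end GaussianProblem.IsStationary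

/-! ### Optimality of the fully probabilistic strategy -/

namespace GaussianProblem

variable {n m : ℕ}

/-- The deviation of the log-likelihood ratio of a transition from its conditional expectation. -/
noncomputable def logRatioDeviation (D : GaussianProblem n m) (T t : ℕ) (x : Fin n → ℝ)
    (u : Fin m → ℝ) (x' : Fin n → ℝ) : ℝ :=
  Real.log (D.modelPdf t x u x' / (D.gammaFn T t x' * D.idealStatePdf t x')) - D.omegaFn T t x u

namespace IsStationary

variable {D : GaussianProblem n m} {A : Matrix (Fin n) (Fin n) ℝ}
  {B : Matrix (Fin n) (Fin m) ℝ} {Ix : Matrix (Fin n) (Fin n) ℝ} {Iu : Matrix (Fin m) (Fin m) ℝ}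

lemma exists_omegaFn_eq (hD : D.IsStationary A B Ix Iu) {T t : ℕ} (ht : 1 ≤ t) :
    ∃ c K : ℝ, 0 ≤ K ∧ (∀ x u, D.omegaFn T t x u = c + 1 / 2 * ((A *ᵥ x + B *ᵥ u) ⬝ᵥ
        (riccatiIter A B Ix⁻¹ Iu (T - t) *ᵥ (A *ᵥ x + B *ᵥ u)))) ∧
      ∀ x u x', |Real.log (D.modelPdf t x u x' / (D.gammaFn T t x' * D.idealStatePdf t x'))| ≤
        K * (1 + x' ⬝ᵥ x' + (A *ᵥ x + B *ᵥ u) ⬝ᵥ (A *ᵥ x + B *ᵥ u)) := by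
  obtain ⟨C, hC, hg⟩ := hD.exists_gammaToGo_eq (T - t) t
  obtain ⟨c, K, hK, h⟩ := hD.exists_step_of_gamma ht hC hg
  exact ⟨c, K, hK, fun x u => (h x u).2.1, fun x u => (h x u).2.2⟩

lemma measurable_logRatioDeviation (hD : D.IsStationary A B Ix Iu) {T t : ℕ} (ht : 1 ≤ t) :
    Measurable fun p : ((Fin n → ℝ) × (Fin m → ℝ)) × (Fin n → ℝ) =>
      D.logRatioDeviation T t p.1.1 p.1.2 p.2 := by
  obtain ⟨c, -, -, hω, -⟩ := hD.exists_omegaFn_eq (T := T) ht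
  have h1 : Measurable fun p : ((Fin n → ℝ) × (Fin m → ℝ)) × (Fin n → ℝ) =>
      D.omegaFn T t p.1.1 p.1.2 := by
    simp only [hω]
    exact Continuous.measurable (by fun_prop)
  have h2 : Measurable fun p : ((Fin n → ℝ) × (Fin m → ℝ)) × (Fin n → ℝ) =>
      D.gammaFn T t p.2 :=
    (hD.continuous_gammaToGo (T - t) t).measurable.comp measurable_snd
  have h3 : Measurable fun p : ((Fin n → ℝ) × (Fin m → ℝ)) × (Fin n → ℝ) =>
      D.idealStatePdf t p.2 := by
    rw [hD.idealStatePdf_eq ht]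
    exact (measurable_gaussianPdf 0 Ix).comp measurable_snd
  exact (Real.measurable_log.comp
    ((continuous_modelPdf (D := D) t).measurable.div (h2.mul h3))).sub h1

/-- By definition, `ω` is the conditional expectation of the log ratio under the model. This is the
martingale-difference property. -/
lemma integral_modelPdf_mul_logRatioDeviation (hD : D.IsStationary A B Ix Iu) {T t : ℕ}
    (ht : 1 ≤ t) (x : Fin n → ℝ) (u : Fin m → ℝ) :
    ∫ x', D.modelPdf t x u x' * D.logRatioDeviation T t x u x' = 0 := by
  have h1 := hD.integrable_omegaIntegrand (T := T) ht x u
  have h2 := (integrable_modelPdf hD.noiseCov_posDef ht x u).mul_const (D.omegaFn T t x u)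
  have h3 : ∀ x', D.modelPdf t x u x' * D.logRatioDeviation T t x u x' =
      D.omegaIntegrand t (D.gammaFn T t) x u x' - D.modelPdf t x u x' * D.omegaFn T t x u :=
    fun x' => by rw [logRatioDeviation, omegaIntegrand, mul_sub]
  simp only [h3]
  rw [integral_sub h1 h2, integral_mul_const, integral_modelPdf hD.noiseCov_posDef ht, omegaFn]
  ring

/-- Both the log ratio and `ω` grow quadratically, so finite second moments suffice to integrate the
deviation in closed loop. -/
lemma exists_abs_logRatioDeviation_le (hD : D.IsStationary A B Ix Iu) {T t : ℕ} (ht : 1 ≤ t) :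
    ∃ K : ℝ, 0 ≤ K ∧ ∀ x u x', |D.logRatioDeviation T t x u x'| ≤
      K * (1 + x ⬝ᵥ x + u ⬝ᵥ u + x' ⬝ᵥ x') := by
  obtain ⟨c, K, hK, hω, hl⟩ := hD.exists_omegaFn_eq (T := T) ht
  obtain ⟨K₁, hK₁, h₁⟩ := exists_abs_quadratic_le (riccatiIter A B Ix⁻¹ Iu (T - t))
  obtain ⟨K₂, hK₂, h₂⟩ := exists_mulVec_dotProduct_self_le A
  obtain ⟨K₃, hK₃, h₃⟩ := exists_mulVec_dotProduct_self_le B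
  refine ⟨|c| + K + (K + K₁) * (2 * K₂ + 2 * K₃), by positivity, fun x u x' => ?_⟩
  have e1 := h₁ (A *ᵥ x + B *ᵥ u)
  have e2 := hl x u x'
  have e3 := add_dotProduct_self_le (A *ᵥ x) (B *ᵥ u)
  have e4 := h₂ x
  have e5 := h₃ u
  have e6 := dotProduct_self_nonneg_real x
  have e7 := dotProduct_self_nonneg_real u
  have e8 := dotProduct_self_nonneg_real x'
  have e9 := dotProduct_self_nonneg_real (A *ᵥ x + B *ᵥ u)
  have e10 : (A *ᵥ x + B *ᵥ u) ⬝ᵥ (A *ᵥ x + B *ᵥ u) ≤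
      (2 * K₂ + 2 * K₃) * (1 + x ⬝ᵥ x + u ⬝ᵥ u + x' ⬝ᵥ x') := by
    have : 0 ≤ K₂ * (1 + u ⬝ᵥ u + x' ⬝ᵥ x') := by positivity
    have : 0 ≤ K₃ * (1 + x ⬝ᵥ x + x' ⬝ᵥ x') := by positivity
    nlinarith
  rw [logRatioDeviation, hω]
  generalize Real.log (D.modelPdf t x u x' / (D.gammaFn T t x' * D.idealStatePdf t x')) = l at *
  generalize (A *ᵥ x + B *ᵥ u) ⬝ᵥ (riccatiIter A B Ix⁻¹ Iu (T - t) *ᵥ (A *ᵥ x + B *ᵥ u)) = q at *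
  generalize (A *ᵥ x + B *ᵥ u) ⬝ᵥ (A *ᵥ x + B *ᵥ u) = r at *
  have e11 : |l - (c + 1 / 2 * q)| ≤ |l| + |c| + |q| := by
    rw [abs_le]
    constructor <;>
      linarith [neg_abs_le l, le_abs_self l, neg_abs_le c, le_abs_self c, neg_abs_le q,
        le_abs_self q, abs_nonneg q]
  have e12 := mul_le_mul_of_nonneg_left e10 (add_nonneg hK hK₁)
  have e13 : 0 ≤ |c| * (x ⬝ᵥ x + u ⬝ᵥ u + x' ⬝ᵥ x') := by positivity
  have e14 : 0 ≤ K * (x ⬝ᵥ x + u ⬝ᵥ u) := by positivity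
  linarith

/-- The deviations are integrable in closed loop if second moments are finite. -/
lemma integrable_jointPdf_mul_logRatioDeviation (hD : D.IsStationary A B Ix Iu) {T : ℕ}
    {π : Policy n m} (hπ : IsAdmissible T π) (x₀ : Fin n → ℝ) (k : Fin T)
    (hW : Integrable fun d => D.jointPdf T π x₀ d * trajWeight d) :
    Integrable fun d => D.jointPdf T π x₀ d *
      D.logRatioDeviation T (k + 1) (truncate x₀ d k).lastState (d k).1 (d k).2 := by
  obtain ⟨K, hK, h⟩ := hD.exists_abs_logRatioDeviation_le (T := T) (Nat.le_add_left 1 k)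
  have hm := measurable_transition x₀ k
    (hD.measurable_logRatioDeviation (T := T) (Nat.le_add_left 1 k))
  refine (hW.const_mul (K * (x₀ ⬝ᵥ x₀ + 2))).mono'
    ((measurable_jointPdf hπ x₀).mul hm).aestronglyMeasurable (ae_of_all _ fun d => ?_)
  have h0 := jointPdf_nonneg (D := D) hD.noiseCov_posDef hπ x₀ d
  rw [norm_mul, Real.norm_of_nonneg h0, Real.norm_eq_abs]
  have e1 := h (truncate x₀ d k).lastState (d k).1 (d k).2
  have e2 := truncate_lastState_dotProduct_le x₀ d k
  have e3 := le_trajWeight d k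
  have e4 : K * (1 + (truncate x₀ d k).lastState ⬝ᵥ (truncate x₀ d k).lastState +
      (d k).1 ⬝ᵥ (d k).1 + (d k).2 ⬝ᵥ (d k).2) ≤ K * ((x₀ ⬝ᵥ x₀ + 2) * trajWeight d) := by
    refine mul_le_mul_of_nonneg_left ?_ hK
    linarith
  refine (mul_le_mul_of_nonneg_left (e1.trans e4) h0).trans (le_of_eq ?_)
  ring

lemma policyMean_eq (hD : D.IsStationary A B Ix Iu) (T t : ℕ) (ht : 1 ≤ t) (x : Fin n → ℝ) :
    D.policyMean T t x = -(((Iu⁻¹ + Bᵀ * riccatiIter A B Ix⁻¹ Iu (T - t) * B)⁻¹ * Bᵀ *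
      riccatiIter A B Ix⁻¹ Iu (T - t) * A) *ᵥ x) := by
  rw [policyMean, gammaParams, hD.policyMeanOf_paramsToGo _ t ht]
  simp only [Matrix.mulVec_mulVec, Matrix.mul_assoc]

lemma controlPolicy_eq (hD : D.IsStationary A B Ix Iu) {T k : ℕ} (hk : k < T)
    (h : History n m k) (u : Fin m → ℝ) :
    D.controlPolicy T k h u =
      gaussianPdf (D.policyMean T (k + 1) h.lastState) (D.policyCov T (k + 1)) u :=
  hD.controlPdf_eq (Nat.le_add_left 1 k) hk h.lastState u

lemma posDef_policyCov (hD : D.IsStationary A B Ix Iu) (T : ℕ) {t : ℕ} (ht : 1 ≤ t) :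
    (D.policyCov T t).PosDef :=
  hD.posDef_policyCovOf (T - t) t ht

lemma isAdmissible_controlPolicy (hD : D.IsStationary A B Ix Iu) (T : ℕ) :
    IsAdmissible T (D.controlPolicy T) := by
  intro k hk
  have hV := hD.posDef_policyCov T (Nat.le_add_left 1 k)
  refine ⟨?_, fun h u => ?_, fun h => ?_⟩
  · have h1 : Function.uncurry (D.controlPolicy T k) = fun p : History n m k × (Fin m → ℝ) =>
        gaussianPdf (D.policyMean T (k + 1) p.1.lastState) (D.policyCov T (k + 1)) p.2 :=
      funext fun p => hD.controlPolicy_eq hk p.1 p.2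
    have h2 : Continuous (D.policyMean T (k + 1)) := by
      rw [funext (hD.policyMean_eq T (k + 1) (Nat.le_add_left 1 k))]
      fun_prop
    have h3 : Measurable fun p : History n m k × (Fin m → ℝ) =>
        (D.policyMean T (k + 1) p.1.lastState, p.2) :=
      (h2.measurable.comp ((measurable_lastState k).comp measurable_fst)).prodMk measurable_snd
    have h4 := (continuous_gaussianPdf (D.policyCov T (k + 1))).measurable.comp h3
    rw [h1]
    exact h4
  · rw [hD.controlPolicy_eq hk]
    exact (gaussianPdf_pos hV _ _).le
  · simp only [hD.controlPolicy_eq hk]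
    exact integral_gaussianPdf hV _

lemma jointPdf_controlPolicy_pos (hD : D.IsStationary A B Ix Iu) (T : ℕ) (x₀ : Fin n → ℝ)
    (d : Fin T → (Fin m → ℝ) × (Fin n → ℝ)) : 0 < D.jointPdf T (D.controlPolicy T) x₀ d := by
  refine Finset.prod_pos fun k _ => ?_
  rw [hD.controlPolicy_eq k.isLt]
  exact mul_pos (modelPdf_pos hD.noiseCov_posDef (Nat.le_add_left 1 _) _ _ _)
    (gaussianPdf_pos (hD.posDef_policyCov T (Nat.le_add_left 1 _)) _ _)

lemma integrable_jointPdf_controlPolicy_mul_trajWeight (hD : D.IsStationary A B Ix Iu) (T : ℕ)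
    (x₀ : Fin n → ℝ) :
    Integrable fun d => D.jointPdf T (D.controlPolicy T) x₀ d * trajWeight d := by
  refine integrable_jointPdf_mul_trajWeight hD.noiseCov_posDef (hD.isAdmissible_controlPolicy T)
    (fun k hk => ?_) x₀
  obtain ⟨K, hK, h⟩ := exists_mulVec_dotProduct_self_le
    ((Iu⁻¹ + Bᵀ * riccatiIter A B Ix⁻¹ Iu (T - (k + 1)) * B)⁻¹ * Bᵀ *
      riccatiIter A B Ix⁻¹ Iu (T - (k + 1)) * A)
  refine ⟨D.policyMean T (k + 1), D.policyCov T (k + 1), K,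
    hD.posDef_policyCov T (Nat.le_add_left 1 k), hK, fun x => ?_,
    fun h u => hD.controlPolicy_eq hk h u⟩
  rw [hD.policyMean_eq T (k + 1) (Nat.le_add_left 1 k), neg_dotProduct, dotProduct_neg, neg_neg]
  exact h x

/-- The log-likelihood ratio of the optimal closed loop and the ideal. -/
lemma log_jointPdf_controlPolicy_div (hD : D.IsStationary A B Ix Iu) (T : ℕ) (x₀ : Fin n → ℝ)
    (d : Fin T → (Fin m → ℝ) × (Fin n → ℝ)) :
    Real.log (D.jointPdf T (D.controlPolicy T) x₀ d / D.idealJointPdf T d) =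
      ∑ k : Fin T, D.logRatioDeviation T (k + 1) (truncate x₀ d k).lastState (d k).1 (d k).2 -
        Real.log (D.gammaFn T 0 x₀) := by
  -- `σ j` is the state `x_j`, stored at index `j - 1` of `d` for `j ≥ 1`. The default `0` occurs
  -- only beyond the horizon and is never reached.
  set σ : ℕ → (Fin n → ℝ) := fun j =>
    if j = 0 then x₀ else if h : j - 1 < T then (d ⟨j - 1, h⟩).2 else 0 with hσ
  have hσ0 : σ 0 = x₀ := by simp [hσ]
  have hσ1 : ∀ k : Fin T, (d k).2 = σ (k + 1) := fun k => by simp [hσ]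
  have hσ2 : ∀ k : Fin T, (truncate x₀ d k).lastState = σ k := by
    rintro ⟨k, hk⟩
    cases k with
    | zero => exact hσ0.symm
    | succ k => exact hσ1 ⟨k, by omega⟩
  -- The input factor contributes `-ω - log γ` at the old state. Adding and subtracting `log γ` at
  -- the new state completes the deviation and leaves a telescoping difference.
  have hterm : ∀ k : Fin T, Real.log
      (D.modelPdf (k + 1) (truncate x₀ d k).lastState (d k).1 (d k).2 *
        D.controlPolicy T k (truncate x₀ d k) (d k).1 /
        (D.idealStatePdf (k + 1) (d k).2 * D.idealControlPdf (k + 1) (d k).1)) =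
      D.logRatioDeviation T (k + 1) (truncate x₀ d k).lastState (d k).1 (d k).2 +
        (Real.log (D.gammaFn T (k + 1) (σ (k + 1))) - Real.log (D.gammaFn T k (σ k))) := by
    intro k
    have p1 := modelPdf_pos hD.noiseCov_posDef (Nat.le_add_left 1 k) (truncate x₀ d k).lastState
      (d k).1 (d k).2
    have p2 : 0 < D.idealStatePdf (k + 1) (d k).2 := by
      rw [hD.idealStatePdf_eq (Nat.le_add_left 1 _)]
      exact gaussianPdf_pos hD.posDef_x _ _
    have p3 : 0 < D.idealControlPdf (k + 1) (d k).1 := by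
      rw [hD.idealControlPdf_eq (Nat.le_add_left 1 _)]
      exact gaussianPdf_pos hD.posDef_u _ _
    have p4 : 0 < D.gammaFn T (k + 1) (d k).2 := hD.gammaToGo_pos _ _ _
    have p5 : 0 < D.gammaFn T k (truncate x₀ d k).lastState := hD.gammaToGo_pos _ _ _
    rw [controlPolicy, controlPdf, logRatioDeviation, Nat.add_sub_cancel, ← hσ1, ← hσ2,
      Real.log_div (by positivity) (by positivity), Real.log_mul (by positivity) (by positivity),
      Real.log_div (by positivity) (by positivity), Real.log_mul (by positivity) (by positivity),
      Real.log_mul (by positivity) (by positivity), Real.log_div (by positivity) (by positivity),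
      Real.log_mul (by positivity) (by positivity), Real.log_exp]
    ring
  rw [jointPdf, idealJointPdf, ← Finset.prod_div_distrib, Real.log_prod, Finset.sum_congr rfl
    fun k _ => hterm k, Finset.sum_add_distrib,
    Fin.sum_univ_eq_sum_range (fun k => Real.log (D.gammaFn T (k + 1) (σ (k + 1))) -
      Real.log (D.gammaFn T k (σ k))), Finset.sum_range_sub
      (fun k => Real.log (D.gammaFn T k (σ k))), hσ0]
  -- The terminal condition removes the upper end of the telescoping sum.
  · have : D.gammaFn T T (σ T) = 1 := by simp [gammaFn, gammaToGo]
    rw [this, Real.log_one]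
    ring
  · intro k _
    refine (div_pos (mul_pos (modelPdf_pos hD.noiseCov_posDef (Nat.le_add_left 1 _) _ _ _) ?_)
      (mul_pos ?_ ?_)).ne'
    · rw [hD.controlPolicy_eq k.isLt]
      exact gaussianPdf_pos (hD.posDef_policyCov T (Nat.le_add_left 1 _)) _ _
    · rw [hD.idealStatePdf_eq (Nat.le_add_left 1 _)]
      exact gaussianPdf_pos hD.posDef_x _ _
    · rw [hD.idealControlPdf_eq (Nat.le_add_left 1 _)]
      exact gaussianPdf_pos hD.posDef_u _ _

/-- The divergence to the ideal, relative to the divergence to the optimal closed loop. -/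
lemma jointPdf_mul_log_div (hD : D.IsStationary A B Ix Iu) {T : ℕ}
    {π : Policy n m} (hπ : IsAdmissible T π) (x₀ : Fin n → ℝ)
    (d : Fin T → (Fin m → ℝ) × (Fin n → ℝ)) :
    D.jointPdf T π x₀ d * Real.log (D.jointPdf T π x₀ d / D.idealJointPdf T d) =
      D.jointPdf T π x₀ d *
        Real.log (D.jointPdf T π x₀ d / D.jointPdf T (D.controlPolicy T) x₀ d) +
      (∑ k : Fin T, D.jointPdf T π x₀ d *
        D.logRatioDeviation T (k + 1) (truncate x₀ d k).lastState (d k).1 (d k).2 -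
        D.jointPdf T π x₀ d * Real.log (D.gammaFn T 0 x₀)) := by
  have h1 := jointPdf_nonneg (D := D) hD.noiseCov_posDef hπ x₀ d
  have h2 := hD.jointPdf_controlPolicy_pos T x₀ d
  have h3 := hD.idealJointPdf_pos T d
  have h4 := hD.log_jointPdf_controlPolicy_div T x₀ d
  rw [← Finset.mul_sum, ← mul_sub, ← h4, ← mul_add]
  -- Where the density of `π` vanishes, all terms carry the factor `0`; elsewhere the logarithms
  -- split.
  rcases h1.eq_or_lt with h | h
  · rw [← h]
    simp
  · rw [Real.log_div h.ne' h3.ne', Real.log_div h.ne' h2.ne', Real.log_div h2.ne' h3.ne']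
    ring

/-- The martingale differences integrate to zero and the joint density to one, so the value does not
depend on the strategy. -/
lemma integrable_and_integral_remainder (hD : D.IsStationary A B Ix Iu) {T : ℕ}
    {π : Policy n m} (hπ : IsAdmissible T π) (x₀ : Fin n → ℝ)
    (hW : Integrable fun d => D.jointPdf T π x₀ d * trajWeight d) :
    Integrable (fun d => ∑ k : Fin T, D.jointPdf T π x₀ d *
        D.logRatioDeviation T (k + 1) (truncate x₀ d k).lastState (d k).1 (d k).2 -
        D.jointPdf T π x₀ d * Real.log (D.gammaFn T 0 x₀)) ∧
    ∫ d, (∑ k : Fin T, D.jointPdf T π x₀ d *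
        D.logRatioDeviation T (k + 1) (truncate x₀ d k).lastState (d k).1 (d k).2 -
        D.jointPdf T π x₀ d * Real.log (D.gammaFn T 0 x₀)) = -Real.log (D.gammaFn T 0 x₀) := by
  have h1 := fun k : Fin T => hD.integrable_jointPdf_mul_logRatioDeviation hπ x₀ k hW
  have h2 := integrable_jointPdf_and_integral (D := D) hD.noiseCov_posDef hπ x₀
  have h3 : Integrable fun d => ∑ k : Fin T, D.jointPdf T π x₀ d *
        D.logRatioDeviation T (k + 1) (truncate x₀ d k).lastState (d k).1 (d k).2 :=
    integrable_finsetSum _ fun k _ => h1 k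
  have h4 := h2.1.mul_const (Real.log (D.gammaFn T 0 x₀))
  refine ⟨h3.sub h4, ?_⟩
  rw [integral_sub h3 h4, integral_finsetSum _ fun k _ => h1 k, integral_mul_const, h2.2,
    Finset.sum_eq_zero fun k _ => integral_jointPdf_mul_eq_zero hD.noiseCov_posDef hπ x₀ k
      (hD.measurable_logRatioDeviation (Nat.le_add_left 1 k))
      (hD.integral_modelPdf_mul_logRatioDeviation (Nat.le_add_left 1 k)) (h1 k)]
  ring

/-- The divergence attained by the optimal strategy. -/
lemma cost_controlPolicy (hD : D.IsStationary A B Ix Iu) (T : ℕ) (x₀ : Fin n → ℝ) :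
    D.cost T (D.controlPolicy T) x₀ ≠ ⊤ ∧
      (D.cost T (D.controlPolicy T) x₀).toReal = -Real.log (D.gammaFn T 0 x₀) := by
  have hπ := hD.isAdmissible_controlPolicy T
  have m1 := measurable_jointPdf (D := D) hπ x₀
  have h0 := jointPdf_nonneg (D := D) hD.noiseCov_posDef hπ x₀
  have h1 := (integrable_jointPdf_and_integral (D := D) hD.noiseCov_posDef hπ x₀).2
  obtain ⟨h2, h3⟩ := hD.integrable_and_integral_remainder hπ x₀
    (hD.integrable_jointPdf_controlPolicy_mul_trajWeight T x₀)
  have h4 : (fun d => D.jointPdf T (D.controlPolicy T) x₀ d *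
      Real.log (D.jointPdf T (D.controlPolicy T) x₀ d / D.idealJointPdf T d)) = fun d =>
      ∑ k : Fin T, D.jointPdf T (D.controlPolicy T) x₀ d *
        D.logRatioDeviation T (k + 1) (truncate x₀ d k).lastState (d k).1 (d k).2 -
        D.jointPdf T (D.controlPolicy T) x₀ d * Real.log (D.gammaFn T 0 x₀) := by
    funext d
    rw [hD.jointPdf_mul_log_div hπ, div_self (hD.jointPdf_controlPolicy_pos T x₀ d).ne',
      Real.log_one, mul_zero, zero_add]
  constructor
  · rw [cost, klDivPdf_ne_top_iff m1 (hD.measurable_idealJointPdf T) h0 (hD.idealJointPdf_pos T)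
      (hD.integral_idealJointPdf T), h4]
    exact h2
  · rw [cost, toReal_klDivPdf m1 (hD.measurable_idealJointPdf T) h0 (hD.idealJointPdf_pos T)
      h1 (hD.integral_idealJointPdf T), h4, h3]

/-- The optimality of the fully probabilistic control strategy. -/
lemma cost_controlPolicy_le (hD : D.IsStationary A B Ix Iu) (T : ℕ) (x₀ : Fin n → ℝ)
    {π : Policy n m} (hπ : IsAdmissible T π) :
    D.cost T (D.controlPolicy T) x₀ ≤ D.cost T π x₀ ∧
      (D.cost T π x₀ ≤ D.cost T (D.controlPolicy T) x₀ →
        D.jointPdf T π x₀ =ᵐ[volume] D.jointPdf T (D.controlPolicy T) x₀) := by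
  obtain ⟨ht, hc⟩ := hD.cost_controlPolicy T x₀
  by_cases hfin : D.cost T π x₀ = ⊤
  · rw [hfin]
    exact ⟨le_top, fun h => absurd (top_le_iff.mp h) ht⟩
  have m1 := measurable_jointPdf (D := D) hπ x₀
  have m2 := hD.measurable_idealJointPdf T
  have m3 := measurable_jointPdf (D := D) (hD.isAdmissible_controlPolicy T) x₀
  have p1 := jointPdf_nonneg (D := D) hD.noiseCov_posDef hπ x₀
  have p2 := hD.idealJointPdf_pos T
  have p3 := hD.jointPdf_controlPolicy_pos T x₀
  obtain ⟨i1, e1⟩ := integrable_jointPdf_and_integral (D := D) hD.noiseCov_posDef hπ x₀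
  have e2 := hD.integral_idealJointPdf T
  have e3 := (integrable_jointPdf_and_integral (D := D) hD.noiseCov_posDef
    (hD.isAdmissible_controlPolicy T) x₀).2
  have hi := (klDivPdf_ne_top_iff m1 m2 p1 p2 e2).mp hfin
  -- No moment condition is imposed on `π`: finite divergence from a density with a square
  -- exponential moment forces finite second moments.
  have hW : Integrable fun d => D.jointPdf T π x₀ d * trajWeight d := by
    obtain ⟨ε, hε, h⟩ := hD.exists_integrable_idealJointPdf_mul_exp T
    have h1 := (integrable_mul_of_integrable_exp m1 p1 p2 i1 (g := fun d => ε * trajWeight d)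
      (continuous_trajWeight.measurable.const_mul ε)
      (fun d => mul_nonneg hε.le (by linarith [one_le_trajWeight d])) hi h).const_mul ε⁻¹
    refine h1.congr (ae_of_all _ fun d => ?_)
    simp only
    field_simp
  obtain ⟨h2, h3⟩ := hD.integrable_and_integral_remainder hπ x₀ hW
  have hj : Integrable fun d => D.jointPdf T π x₀ d *
      Real.log (D.jointPdf T π x₀ d / D.jointPdf T (D.controlPolicy T) x₀ d) := by
    refine (hi.sub h2).congr (ae_of_all _ fun d => ?_)
    simp only [Pi.sub_apply]
    rw [hD.jointPdf_mul_log_div hπ, add_sub_cancel_right]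
  -- The Pythagorean identity: the excess cost of `π` is its divergence from the optimal closed
  -- loop.
  have hcπ : (D.cost T π x₀).toReal = (∫ d, D.jointPdf T π x₀ d *
      Real.log (D.jointPdf T π x₀ d / D.jointPdf T (D.controlPolicy T) x₀ d)) +
      (D.cost T (D.controlPolicy T) x₀).toReal := by
    rw [hc, cost, toReal_klDivPdf m1 m2 p1 p2 e1 e2]
    simp only [hD.jointPdf_mul_log_div hπ]
    rw [integral_add hj h2, h3]
  constructor
  · rw [← ENNReal.toReal_le_toReal ht hfin, hcπ]
    linarith [integral_mul_log_div_nonneg m1 m3 p1 p3 e1 e3]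
  · intro hle
    rw [← ENNReal.toReal_le_toReal hfin ht, hcπ] at hle
    exact ae_eq_of_integral_mul_log_div_eq_zero m1 m3 p1 p3 e1 e3 hj (by linarith)

end IsStationary

end GaussianProblem

/-! ### Limits as the horizon tends to infinity -/

lemma tendsto_gaussianPdf {ι : Type*} {l : Filter ι} {k : ℕ} {μ : ι → Fin k → ℝ}
    {S : ι → Matrix (Fin k) (Fin k) ℝ} {μ' : Fin k → ℝ} {S' : Matrix (Fin k) (Fin k) ℝ}
    (hS : S'.PosDef) (h₁ : Tendsto μ l (𝓝 μ')) (h₂ : Tendsto S l (𝓝 S')) (x : Fin k → ℝ) :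
    Tendsto (fun i => gaussianPdf (μ i) (S i) x) l (𝓝 (gaussianPdf μ' S' x)) := by
  have h3 : Tendsto (fun i => (S i)⁻¹) l (𝓝 S'⁻¹) :=
    (continuousAt_inv_of_posDef hS).tendsto.comp h₂
  have h4 : Continuous fun p : (Fin k → ℝ) × Matrix (Fin k) (Fin k) ℝ =>
      Real.exp (-(1 / 2) * ((x - p.1) ⬝ᵥ (p.2 *ᵥ (x - p.1)))) := by fun_prop
  have h5 : Continuous fun X : Matrix (Fin k) (Fin k) ℝ =>
      Real.sqrt ((2 * Real.pi) ^ k * X.det) := by fun_prop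
  have h6 := ((h5.tendsto S').comp h₂).inv₀ (inv_pos.mp (gaussianPdf_const_pos hS)).ne'
  have h7 := (h4.tendsto (μ', S'⁻¹)).comp (h₁.prodMk_nhds h3)
  exact h6.mul h7

namespace GaussianProblem.IsStationary

variable {n m : ℕ} {D : GaussianProblem n m} {A : Matrix (Fin n) (Fin n) ℝ}
  {B : Matrix (Fin n) (Fin m) ℝ} {Ix : Matrix (Fin n) (Fin n) ℝ} {Iu : Matrix (Fin m) (Fin m) ℝ}
  {P : Matrix (Fin n) (Fin n) ℝ}

/-- At a fixed time the number `T - t` of remaining steps tends to infinity with `T`. -/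
lemma tendsto_omegaPrec (hD : D.IsStationary A B Ix Iu)
    (h : Tendsto (riccatiIter A B Ix⁻¹ Iu) atTop (𝓝 P)) {t : ℕ} (ht : 1 ≤ t) :
    Tendsto (fun T => D.omegaPrec T t) atTop (𝓝 P) := by
  simp only [omegaPrec, gammaParams, hD.omegaPrecOf_paramsToGo _ t ht]
  exact h.comp (tendsto_sub_atTop_nat t)

lemma tendsto_policyCov (hD : D.IsStationary A B Ix Iu) (hP : P.PosDef)
    (h : Tendsto (riccatiIter A B Ix⁻¹ Iu) atTop (𝓝 P)) {t : ℕ} (ht : 1 ≤ t) :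
    Tendsto (fun T => D.policyCov T t) atTop (𝓝 (Iu⁻¹ + Bᵀ * P * B)⁻¹) := by
  simp only [policyCov, gammaParams, hD.policyCovOf_paramsToGo _ t ht]
  have h1 : Continuous fun X : Matrix (Fin n) (Fin n) ℝ => Iu⁻¹ + Bᵀ * X * B := by fun_prop
  exact (continuousAt_inv_of_posDef (posDef_inv_add B hD.posDef_u hP)).tendsto.comp
    ((h1.tendsto P).comp (h.comp (tendsto_sub_atTop_nat t)))

lemma tendsto_policyMean (hD : D.IsStationary A B Ix Iu) (hP : P.PosDef)
    (h : Tendsto (riccatiIter A B Ix⁻¹ Iu) atTop (𝓝 P)) {t : ℕ} (ht : 1 ≤ t) (x : Fin n → ℝ) :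
    Tendsto (fun T => D.policyMean T t x) atTop
      (𝓝 (-(((Iu⁻¹ + Bᵀ * P * B)⁻¹ * Bᵀ * P * A) *ᵥ x))) := by
  have h1 := hD.tendsto_policyCov hP h ht
  simp only [policyCov, gammaParams, hD.policyCovOf_paramsToGo _ t ht] at h1
  simp only [hD.policyMean_eq _ t ht]
  have h2 : Continuous fun p : Matrix (Fin m) (Fin m) ℝ × Matrix (Fin n) (Fin n) ℝ =>
      -((p.1 * Bᵀ * p.2 * A) *ᵥ x) := by fun_prop
  have h3 := (h2.tendsto ((Iu⁻¹ + Bᵀ * P * B)⁻¹, P)).comp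
    (h1.prodMk_nhds (h.comp (tendsto_sub_atTop_nat t)))
  exact h3

lemma tendsto_controlPdf (hD : D.IsStationary A B Ix Iu) (hP : P.PosDef)
    (h : Tendsto (riccatiIter A B Ix⁻¹ Iu) atTop (𝓝 P)) {t : ℕ} (ht : 1 ≤ t) (x : Fin n → ℝ)
    (u : Fin m → ℝ) :
    Tendsto (fun T => D.controlPdf T t x u) atTop
      (𝓝 (gaussianPdf (-(((Iu⁻¹ + Bᵀ * P * B)⁻¹ * Bᵀ * P * A) *ᵥ x))
        (Iu⁻¹ + Bᵀ * P * B)⁻¹ u)) := by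
  refine (tendsto_gaussianPdf (posDef_inv_add B hD.posDef_u hP).inv
    (hD.tendsto_policyMean hP h ht x) (hD.tendsto_policyCov hP h ht) u).congr' ?_
  filter_upwards [eventually_ge_atTop t] with T hT
  rw [hD.controlPdf_eq ht hT]

lemma gammaParams_of_lt (hD : D.IsStationary A B Ix Iu) {T t : ℕ} (ht : t < T) :
    D.gammaParams T t =
      ⟨A, 0, (B * Iu * Bᵀ + (riccatiIter A B Ix⁻¹ Iu (T - (t + 1)))⁻¹)⁻¹⟩ := by
  have h : T - t = T - (t + 1) + 1 := by omega
  rw [gammaParams, h, hD.paramsToGo_succ]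

lemma tendsto_gammaParams_prec (hD : D.IsStationary A B Ix Iu) (hP : P.PosDef)
    (h : Tendsto (riccatiIter A B Ix⁻¹ Iu) atTop (𝓝 P)) (t : ℕ) :
    Tendsto (fun T => (D.gammaParams T t).prec) atTop (𝓝 (B * Iu * Bᵀ + P⁻¹)⁻¹) := by
  have h1 : Tendsto (fun T => B * Iu * Bᵀ + (riccatiIter A B Ix⁻¹ Iu (T - (t + 1)))⁻¹) atTop
      (𝓝 (B * Iu * Bᵀ + P⁻¹)) :=
    ((continuousAt_inv_of_posDef hP).tendsto.comp
      (h.comp (tendsto_sub_atTop_nat (t + 1)))).const_add _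
  have h2 := (continuousAt_inv_of_posDef
    (posDef_mul_mul_add_inv B hD.posDef_u hP)).tendsto.comp h1
  refine h2.congr' ?_
  filter_upwards [eventually_gt_atTop t] with T hT
  rw [hD.gammaParams_of_lt hT]
  rfl

/-- The constant in front of `γ` varies with `T` and need not converge; the quotient by the value at
`0` cancels it. Only `t < T` matters, where `L = A`. -/
lemma tendsto_gammaFn_div (hD : D.IsStationary A B Ix Iu) (hP : P.PosDef)
    (h : Tendsto (riccatiIter A B Ix⁻¹ Iu) atTop (𝓝 P)) (t : ℕ) (x : Fin n → ℝ) :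
    Tendsto (fun T => D.gammaFn T t x / D.gammaFn T t 0) atTop
      (𝓝 (Real.exp (-(1 / 2) * ((A *ᵥ x) ⬝ᵥ ((B * Iu * Bᵀ + P⁻¹)⁻¹ *ᵥ (A *ᵥ x)))))) := by
  have h1 : Continuous fun X : Matrix (Fin n) (Fin n) ℝ =>
      Real.exp (-(1 / 2) * ((A *ᵥ x) ⬝ᵥ (X *ᵥ (A *ᵥ x)))) := by fun_prop
  refine ((h1.tendsto _).comp (hD.tendsto_gammaParams_prec hP h t)).congr' ?_
  filter_upwards [eventually_gt_atTop t] with T hT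
  obtain ⟨C, hC, hg⟩ := hD.exists_gammaToGo_eq (T - t) t
  have hg' : ∀ x, D.gammaFn T t x = C * Real.exp (-(1 / 2) *
      ((A *ᵥ x) ⬝ᵥ ((D.gammaParams T t).prec *ᵥ (A *ᵥ x)))) := fun x => by
    have h2 := hD.gammaParams_of_lt hT
    rw [gammaFn, hg, hD.paramsToGo_M, add_zero]
    have h3 : (D.paramsToGo (T - t) t).L = A := congrArg GammaParams.L h2
    rw [h3]
    rfl
  rw [hg', hg']
  simp only [Function.comp_apply, Matrix.mulVec_zero, dotProduct_zero, mul_zero, Real.exp_zero,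
    mul_one]
  rw [mul_div_cancel_left₀ _ hC.ne']

end GaussianProblem.IsStationary

end FPC

theorem mainTheorem2 {n m : ℕ} (D : FPC.GaussianProblem n m)
    (A : Matrix (Fin n) (Fin n) ℝ) (B : Matrix (Fin n) (Fin m) ℝ)
    (Ix : Matrix (Fin n) (Fin n) ℝ) (Iu : Matrix (Fin m) (Fin m) ℝ)
    -- the model used by the controller is `N(A x_{t-1} + B u_t, noiseCov_t)`
    (hA : ∀ t, 1 ≤ t → D.A t = A) (hB : ∀ t, 1 ≤ t → D.B t = B)
    (hS : ∀ t, 1 ≤ t → (D.noiseCov t).PosDef)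
    -- the ideal covariances are constant and the ideal means are zero
    (hIxc : ∀ t, 1 ≤ t → D.idealCovX t = Ix) (hIuc : ∀ t, 1 ≤ t → D.idealCovU t = Iu)
    (hmx : ∀ t, 1 ≤ t → D.idealMeanX t = 0) (hmu : ∀ t, 1 ≤ t → D.idealMeanU t = 0)
    (hIx : Ix.PosDef) (hIu : Iu.PosDef)
    (hstab : FPC.Stabilizable A B) :
    -- for every finite horizon the algorithm is well defined,
    (∀ T t : ℕ, 1 ≤ t → t ≤ T → ∀ x : Fin n → ℝ,
      (∀ u : Fin m → ℝ, Integrable (D.omegaIntegrand t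
        (D.gammaFn T t) x u)) ∧
      Integrable (fun u : Fin m → ℝ => D.idealControlPdf t u *
        Real.exp (-D.omegaFn T t x u))) ∧
    -- returns the optimal admissible strategy for the approximate model,
    (∀ (T : ℕ) (x₀ : Fin n → ℝ),
      FPC.IsAdmissible T (D.controlPolicy T) ∧
      D.cost T (D.controlPolicy T) x₀
        ≠ ⊤ ∧
      ∀ π : FPC.Policy n m, FPC.IsAdmissible T π →
        D.cost T
            (D.controlPolicy T) x₀
          ≤ D.cost T π x₀ ∧
        (D.cost T π x₀
            ≤ D.cost T
              (D.controlPolicy T) x₀ →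
          D.jointPdf T π x₀ =ᵐ[volume]
            D.jointPdf T
              (D.controlPolicy T) x₀)) ∧
    -- and is given by the recursively computed Gaussian parameters;
    (∀ T t : ℕ, 1 ≤ t → t ≤ T → ∀ (x : Fin n → ℝ) (u : Fin m → ℝ),
      (D.policyCov T t).PosDef ∧
      D.controlPdf T t x u =
        FPC.gaussianPdf (D.policyMean T t x)
          (D.policyCov T t) u) ∧
    (∀ T t : ℕ, t ≤ T → ∃ C : ℝ, 0 < C ∧ ∀ x : Fin n → ℝ,
      D.gammaFn T t x =
        C * Real.exp (-(1 / 2) *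
          (((D.gammaParams T t).L *ᵥ x +
              (D.gammaParams T t).M) ⬝ᵥ
            ((D.gammaParams T t).prec *ᵥ
              ((D.gammaParams T t).L *ᵥ x +
                (D.gammaParams T t).M))))) ∧
    -- as the horizon tends to infinity, everything converges to the stationary solution.
    ∃ (Sω Sγ : Matrix (Fin n) (Fin n) ℝ) (Su : Matrix (Fin m) (Fin m) ℝ),
      Sω.PosDef ∧ Sγ.PosDef ∧ Su.PosDef ∧
      Su⁻¹ = Iu⁻¹ + Bᵀ * Sω⁻¹ * B ∧
      Sγ⁻¹ = Sω⁻¹ * (Sω - B * Su * Bᵀ) * Sω⁻¹ ∧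
      FPC.SolvesDARE A B Ix⁻¹ Iu⁻¹ Sω⁻¹ ∧
      (∀ t : ℕ, 1 ≤ t →
        Tendsto (fun T => D.omegaPrec T t) atTop (𝓝 Sω⁻¹) ∧
        Tendsto (fun T => D.policyCov T t) atTop (𝓝 Su) ∧
        ∀ x : Fin n → ℝ,
          Tendsto (fun T => D.policyMean T t x) atTop
            (𝓝 (-((Su * Bᵀ * Sω⁻¹ * A) *ᵥ x))) ∧
          ∀ u : Fin m → ℝ,
            Tendsto (fun T => D.controlPdf T t x u) atTop
              (𝓝 (FPC.gaussianPdf (-((Su * Bᵀ * Sω⁻¹ * A) *ᵥ x)) Su u))) ∧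
      (∀ t : ℕ,
        Tendsto (fun T => (D.gammaParams T t).prec) atTop
          (𝓝 Sγ⁻¹) ∧
        ∀ x : Fin n → ℝ,
          Tendsto (fun T => D.gammaFn T t x /
              D.gammaFn T t 0) atTop
            (𝓝 (Real.exp (-(1 / 2) * ((A *ᵥ x) ⬝ᵥ (Sγ⁻¹ *ᵥ (A *ᵥ x))))))) := by
  have hD : D.IsStationary A B Ix Iu := ⟨hA, hB, hS, hIxc, hIuc, hmx, hmu, hIx, hIu⟩
  refine ⟨fun T t ht _ x => ⟨fun u => hD.integrable_omegaIntegrand ht x u,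
      hD.integrable_idealControlPdf_mul_exp ht x⟩,
    fun T x₀ => ⟨hD.isAdmissible_controlPolicy T, (hD.cost_controlPolicy T x₀).1,
      fun π hπ => hD.cost_controlPolicy_le T x₀ hπ⟩,
    fun T t ht htT x u => ⟨hD.posDef_policyCov T ht, hD.controlPdf_eq ht htT x u⟩,
    fun T t _ => hD.exists_gammaToGo_eq (T - t) t, ?_⟩
  obtain ⟨P, hP, hlim, hfix⟩ := FPC.exists_tendsto_riccatiIter hIx.inv hIu hstab
  have hW := FPC.posDef_inv_add B hIu hP
  have hG := FPC.posDef_mul_mul_add_inv B hIu hP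
  have hPP : P⁻¹⁻¹ = P := by
    have := hP.isUnit.invertible
    exact Matrix.inv_inv_of_invertible P
  -- With `P` the Riccati limit, these are the covariances whose inverses are the limiting
  -- precisions.
  refine ⟨P⁻¹, B * Iu * Bᵀ + P⁻¹, (Iu⁻¹ + Bᵀ * P * B)⁻¹, hP.inv, hG, hW.inv, ?_, ?_, ?_, ?_, ?_⟩
  · have := hW.isUnit.invertible
    rw [Matrix.inv_inv_of_invertible, hPP]
  -- The matrix inversion lemma, factored as `P - P B Su Bᵀ P = P (P⁻¹ - B Su Bᵀ) P`.
  · have := hP.isUnit.invertible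
    rw [FPC.inv_mul_mul_add_inv B hIu hP, hPP, Matrix.mul_sub, Matrix.sub_mul,
      Matrix.mul_inv_of_invertible, Matrix.one_mul]
    simp only [Matrix.mul_assoc]
  · rw [hPP]
    exact FPC.solvesDARE_of_riccatiMap_eq hIu hP hfix
  · intro t ht
    rw [hPP]
    exact ⟨hD.tendsto_omegaPrec hlim ht, hD.tendsto_policyCov hP hlim ht,
      fun x => ⟨hD.tendsto_policyMean hP hlim ht x, hD.tendsto_controlPdf hP hlim ht x⟩⟩
  · exact fun t => ⟨hD.tendsto_gammaParams_prec hP hlim t, hD.tendsto_gammaFn_div hP hlim t⟩
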